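/- **Setting.** Let $C$ be a smooth connected projective curve over $\mathbb{C}$ (a compact connected Riemann surface), let $n\ge 1$, and for $i=1,\dots,n$ let $\varphi_i\colon C\hookrightarrow\mathbb{P}^{r_i}$ be an embedding whose image $C_i=\varphi_i(C)$ is contained in no hyperplane. Put the $\mathbb{P}^{r_i}$ as mutually skew linear subspaces spanning $\mathbb{P}^N$, $N+1=\sum_i (r_i+1)$. For $p\in C$ write $p_i=\varphi_i(p)$ and $f_p=\langle p_1,\dots,p_n\rangle\cong\mathbb{P}^{n-1}$. The decomposable scroll generated by $C_1,\dots,C_n$ is $X=\bigcup_{p\in C} f_p\subset\mathbb{P}^N$, an embedded smooth variety of dimension $n$. For a smooth $Y\subset\mathbb{P}^M$ and $y\in Y$, the $k$-th osculating space $\mathrm{Osc}^k_y(Y)\subseteq\mathbb{P}^M$ is the linear subspace spanned by the partial derivatives of order $\le k$ at $y$ of the homogeneous coordinates of the points of $Y$, written as holomorphic functions of local coordinates of $Y$ at $y$. One has $\dim\mathrm{Osc}^2_x(X)\le 2n$ for all $x\in X$; put $$\Phi_2(X)=\{x\in X:\dim \mathrm{Osc}^2_x(X)<2n\}.$$ **Proposition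 4.2.** Assume $\Phi_2(X)\ne X$, and let $G$ be an irreducible component of $\Phi_2(X)$ (for the Zariski topology). Then, up to reordering the curves $C_i$, there is an integer $1\le s\le n$ such that one of the following holds: 1. $G=\langle p_1,\dots,p_s\rangle\subseteq f_p$ for some $p\in C$; or 2. $X$ is rational, that is $C\cong\mathbb{P}^1$; the curves $C_1,\dots,C_s$ are lines; and $G=\bigcup_{p\in C}\langle p_1,\dots,p_s\rangle$ is the image of $\mathbb{P}^1\times\mathbb{P}^{s-1}$ by the Segre embedding into the linear span of $C_1,\dots,C_s$, the fibre over the point of $\mathbb{P}^1$ corresponding to $p$ being $\langle p_1,\dots,p_s\rangle$, with $p_1,\dots,p_s$ corresponding to the coordinate points of $\mathbb{P}^{s-1}$. Moreover, $$\mathrm{Osc}^2_x(X)=\langle \mathrm{Osc}^2_{p_1}(C_1),\mathrm{Osc}^1_{p_2}(C_2),\dots,\mathrm{Osc}^1_{p_n}(C_n)\rangle$$ for all $x\in G$ in case (1), and for all $p\in C$ and $x\in G\cap f_p$ in case (2); the ordering of $C_1,\dots,C_s$ being arbitrary, any of them may play the role of $C_1$. In particular $\dim \mathrm{Osc}^2_x(X)=2n-1$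 for every $x\in G$ in both cases. -/

import Mathlib

open scoped LinearAlgebra.Projectivization Manifold ContDiff Topology

noncomputable section

/-! Projective space with homogeneous coordinates indexed by `ι` is `ℙ ℂ (ι → ℂ)`. Linear subspaces
of it are handled through the vector subspaces of `ι → ℂ` over which they are the projectivization. -/

/-- Dimension of the projective linear subspace attached to a vector subspace. -/
def projDim {ι : Type*} (T : Submodule ℂ (ι → ℂ)) : ℤ := (Module.finrank ℂ T : ℤ) - 1

/-- The set of points of the projective linear subspace attached to a vector subspace. -/
def linearSubspace {ι : Type*} (T : Submodule ℂ (ι → ℂ)) : Set (ℙ ℂ (ι → ℂ)) :=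
  {x | x.submodule ≤ T}

/-- The (punctured) affine cone over a subset of projective space. -/
def affineCone {ι : Type*} (X : Set (ℙ ℂ (ι → ℂ))) : Set (ι → ℂ) :=
  {w | ∃ hw : w ≠ 0, Projectivization.mk ℂ w hw ∈ X}

/-- The Zariski topology of projective space: the sets where a homogeneous polynomial does not
vanish form a basis of it. -/
@[reducible] def zariskiTopology (ι : Type*) : TopologicalSpace (ℙ ℂ (ι → ℂ)) :=
  TopologicalSpace.generateFrom
    {U | ∃ (f : MvPolynomial ι ℂ) (d : ℕ), f.IsHomogeneous d ∧ U = {x | MvPolynomial.eval x.rep f ≠ 0}}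

/-- `G` is an irreducible component of the subset `S` of projective space, for the Zariski topology:
a maximal irreducible subset of `S`. -/
def IsIrredComponentOf {ι : Type*} (G S : Set (ℙ ℂ (ι → ℂ))) : Prop :=
  Maximal (fun T => T ⊆ S ∧ @IsIrreducible _ (zariskiTopology ι) T) G

/-! ### Osculating spaces -/

/-- `F`, defined near `0 ∈ ℂ^d`, gives homogeneous coordinates, depending holomorphically on `d` local
coordinates, of the points of `X` near `x`: it is an immersion into projective space (`F 0` and the
partial derivatives at `0` are linearly independent) and its image is exactly `X` near `x`. The last
condition is stated on the affine cone, whose local parametrization is `(c, u) ↦ c F(u)`. -/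
structure IsLocalParam {ι : Type*} [Fintype ι] (d : ℕ) (X : Set (ℙ ℂ (ι → ℂ))) (x : ℙ ℂ (ι → ℂ))
    (F : (Fin d → ℂ) → ι → ℂ) : Prop where
  analytic : AnalyticAt ℂ F 0
  base : ∃ h : F 0 ≠ 0, Projectivization.mk ℂ (F 0) h = x
  immersion : ∀ (c : ℂ) (v : Fin d → ℂ), c • F 0 + fderiv ℂ F 0 v = 0 → c = 0 ∧ v = 0
  image : Filter.map (fun q : ℂ × (Fin d → ℂ) => q.1 • F q.2) (𝓝 (1, 0)) = 𝓝[affineCone X] (F 0)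

/-- The `k`-th osculating space at `x` to the `d`-dimensional complex submanifold `X` of projective
space: the linear space spanned by the rows of the matrix of the `k`-th jet map at `x`, that is,
by all partial derivatives of order `≤ k`, at `x`, of the homogeneous coordinates of the points
of `X` as functions of local coordinates (every choice of local coordinates and of homogeneous
coordinates gives the same span). -/
def osculatingSpace {ι : Type*} [Fintype ι] (k d : ℕ) (X : Set (ℙ ℂ (ι → ℂ))) (x : ℙ ℂ (ι → ℂ)) :
    Submodule ℂ (ι → ℂ) :=
  Submodule.span ℂ {w | ∃ F : (Fin d → ℂ) → ι → ℂ, IsLocalParam d X x F ∧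
    ∃ j ≤ k, ∃ m : Fin j → Fin d → ℂ, w = iteratedFDeriv ℂ j F 0 m}

/-- The `k`-th inflectional locus of a `d`-dimensional scroll `X`: the points where the dimension of
the `k`-th osculating space is less than `d * k`, its largest possible value for a scroll. -/
def inflectionalLocus {ι : Type*} [Fintype ι] (k d : ℕ) (X : Set (ℙ ℂ (ι → ℂ))) :
    Set (ℙ ℂ (ι → ℂ)) :=
  {x | x ∈ X ∧ projDim (osculatingSpace k d X x) < (d : ℤ) * k}

/-! ### Embedded curves -/

/-- A holomorphic embedding of a compact Riemann surface into projective space: an injective map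
which, around every point, is given by holomorphic homogeneous coordinates without common zeros,
and which is an immersion (the point and the derivative in a local coordinate are linearly
independent). -/
def IsProjEmbedding {C : Type*} [TopologicalSpace C] [ChartedSpace ℂ C] {ι : Type*} [Fintype ι]
    (φ : C → ℙ ℂ (ι → ℂ)) : Prop :=
  Function.Injective φ ∧ ∀ p : C, ∃ F : C → ι → ℂ,
    ContMDiffAt 𝓘(ℂ, ℂ) 𝓘(ℂ, ι → ℂ) ω F p ∧
    (∀ᶠ q in 𝓝 p, ∃ h : F q ≠ 0, φ q = Projectivization.mk ℂ (F q) h) ∧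
    LinearIndependent ℂ ![F p, deriv (F ∘ (chartAt ℂ p).symm) (chartAt ℂ p p)]

/-- The image of the map is contained in no hyperplane. -/
def IsNondegenerate {C : Type*} {ι : Type*} (φ : C → ℙ ℂ (ι → ℂ)) : Prop :=
  (⨆ p, (φ p).submodule) = ⊤

/-! ### Decomposable scrolls -/

/-- Index set of the homogeneous coordinates of `ℙ^N`, the union of those of the `ℙ^{r i}`. -/
abbrev ScrollIdx {n : ℕ} (r : Fin n → ℕ) : Type := Σ i : Fin n, Fin (r i + 1)

/-- The inclusion, as a coordinate subspace, of the vector space over `ℙ^{r i}` in the one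
over `ℙ^N`. -/
def blockIncl {n : ℕ} (r : Fin n → ℕ) (i : Fin n) :
    (Fin (r i + 1) → ℂ) →ₗ[ℂ] (ScrollIdx r → ℂ) :=
  Function.ExtendByZero.linearMap ℂ (fun k : Fin (r i + 1) => (⟨i, k⟩ : ScrollIdx r))

/-- The linear space spanned by the points `p_i = φ i p`, `i ∈ S`, in `ℙ^N`. -/
def fibreSpan {C : Type*} {n : ℕ} {r : Fin n → ℕ} (φ : ∀ i, C → ℙ ℂ (Fin (r i + 1) → ℂ))
    (S : Finset (Fin n)) (p : C) : Submodule ℂ (ScrollIdx r → ℂ) :=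
  ⨆ i ∈ S, (φ i p).submodule.map (blockIncl r i)

/-- The scroll generated by the curves `C_i = φ i (C)`, `i ∈ S`: the union over `p` of the linear
spaces spanned by the `p_i`, `i ∈ S`. -/
def subScroll {C : Type*} {n : ℕ} {r : Fin n → ℕ} (φ : ∀ i, C → ℙ ℂ (Fin (r i + 1) → ℂ))
    (S : Finset (Fin n)) : Set (ℙ ℂ (ScrollIdx r → ℂ)) :=
  ⋃ p, linearSubspace (fibreSpan φ S p)

/-- The decomposable scroll generated by all the curves `C_i`. -/
def decomposableScroll {C : Type*} {n : ℕ} {r : Fin n → ℕ}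
    (φ : ∀ i, C → ℙ ℂ (Fin (r i + 1) → ℂ)) : Set (ℙ ℂ (ScrollIdx r → ℂ)) :=
  subScroll φ Finset.univ

/-- The `k`-th osculating space to the curve `C_i` at `p_i`, as a linear subspace of `ℙ^N`. -/
def curveOsc {C : Type*} {n : ℕ} {r : Fin n → ℕ} (φ : ∀ i, C → ℙ ℂ (Fin (r i + 1) → ℂ))
    (k : ℕ) (i : Fin n) (p : C) : Submodule ℂ (ScrollIdx r → ℂ) :=
  (osculatingSpace k 1 (Set.range (φ i)) (φ i p)).map (blockIncl r i)

/-! ### Segre embedding -/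

/-- The Segre map `ℂ² × ℂ^κ → ℂ² ⊗ ℂ^κ` in coordinates. -/
def segre {κ : Type*} (a : Fin 2 → ℂ) (l : κ → ℂ) : Fin 2 × κ → ℂ := fun jk => a jk.1 * l jk.2

/-- The image of the Segre embedding of `ℙ¹ × ℙ(ℂ^κ)`. -/
def segreVariety (κ : Type*) : Set (ℙ ℂ (Fin 2 × κ → ℂ)) :=
  {y | ∃ (a : Fin 2 → ℂ) (l : κ → ℂ), a ≠ 0 ∧ l ≠ 0 ∧ y.submodule = ℂ ∙ segre a l}

/-- `α` identifies `C` with `ℙ¹`, and `G` is the Segre embedded `ℙ¹ × ℙ^{s-1}`, `s = #S`, in the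
linear span of the curves `C_i`, `i ∈ S`: up to a linear isomorphism `Λ` onto this span, `G` is the
Segre variety, and the point `p_i` corresponds to the pair of `α p ∈ ℙ¹` and of the coordinate
point `e_i`. -/
def IsSegreScroll {C : Type*} {n : ℕ} {r : Fin n → ℕ} (φ : ∀ i, C → ℙ ℂ (Fin (r i + 1) → ℂ))
    (S : Finset (Fin n)) (α : C → ℙ ℂ (Fin 2 → ℂ)) (G : Set (ℙ ℂ (ScrollIdx r → ℂ))) : Prop :=
  ∃ (Λ : (Fin 2 × S → ℂ) →ₗ[ℂ] (ScrollIdx r → ℂ)) (hΛ : Function.Injective Λ),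
    LinearMap.range Λ = (⨆ p, fibreSpan φ S p) ∧
    G = Projectivization.map Λ hΛ '' segreVariety S ∧
    ∀ (p : C) (i : S), (φ i p).submodule.map (blockIncl r i) =
      ℂ ∙ Λ (segre (α p).rep (Pi.single i 1))

end

/-! Osculating spaces are studied through their annihilators: a functional ξ kills `Osc^k` at x
exactly when ξ∘F vanishes to order k+1 at 0, for a single local parametrization F. Near a point of
the fibre over p with block coefficients c, choose j with c_j ≠ 0. The scroll is then parametrized
by blocks (c_i + u_i) f_i(z₀ + u_j), where the f_i are local lifts of the curves, the coefficient of
block j is kept equal to c_j, and u_j moves the base point. Expanding, ξ kills `Osc^2` iff every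
ξ∘f_i vanishes to order 2 and Σ c_i ξ∘f_i vanishes to order 3 (`isBigO_scroll_iff`).

The first condition alone describes the annihilator of the span of the tangent lines at p_1, …, p_n,
of vector dimension 2n. Hence `Osc^2` contains that span, and equals it iff each curve with c_i ≠ 0
has a flex at p (`tangentSpan_le_and_eq_iff`). So the inflectional locus is the union over p of the
spans of those p_i that are flexes (`inflectionalLocus_eq`).

Flexes are the common zeros of holomorphic Wronskians, so on each curve they are finite in number or
fill the curve (`IsProjEmbedding.isFlex_or_finite`). In the latter case the tangent line is
constant, and nondegeneracy makes the ambient space a line, onto which the curve maps bijectively.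
Two such embeddings differ by a projectivity (`exists_linearEquiv_of_card_eq_two`), because a
suitable quotient of linear forms has neither zeros nor poles on a compact connected surface. The
scroll generated by all the lines is therefore a Segre variety. Together with finitely many linear
fibres it covers the locus by closed irreducible sets, and every component is one of them
(`component_inflectionalLocus`). -/

noncomputable section

open Asymptotics Filter

/-! ### Order of vanishing and iterated derivatives -/

/-- Both sides say that the homogeneous Taylor terms of degree at most k vanish on the diagonal: a
term of degree j that is O(‖v‖^(j+1)) is zero, and derivatives are recovered from the diagonal by
polarization. -/
theorem AnalyticAt.isBigO_pow_succ_iff {E F : Type*} [NormedAddCommGroup E] [NormedSpace ℂ E]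
    [NormedAddCommGroup F] [NormedSpace ℂ F] [CompleteSpace F]
    {h : E → F} (hh : AnalyticAt ℂ h 0) (k : ℕ) :
    h =O[𝓝 0] (fun v => ‖v‖ ^ (k + 1)) ↔ ∀ j ≤ k, iteratedFDeriv ℂ j h 0 = 0 := by
  obtain ⟨p, ρ, hp⟩ := hh
  have hpa : HasFPowerSeriesAt h p 0 := ⟨ρ, hp⟩
  have hO : ∀ m, (fun y => h y - p.partialSum m y) =O[𝓝 0] fun y => ‖y‖ ^ m := by
    intro m
    simpa using hpa.isBigO_sub_partialSum_pow m
  have mono : ∀ {a b : ℕ}, a ≤ b → (fun v : E => ‖v‖ ^ b) =O[𝓝 0] (fun v => ‖v‖ ^ a) := by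
    intro a b hab
    refine IsBigO.of_bound 1 ?_
    filter_upwards [Metric.closedBall_mem_nhds (0 : E) one_pos] with v hv
    have hv : ‖v‖ ≤ 1 := by simpa using hv
    simp only [norm_pow, norm_norm, one_mul]
    exact pow_le_pow_of_le_one (norm_nonneg _) hv hab
  constructor
  · intro hk
    have diag : ∀ j ≤ k, ∀ y, p j (fun _ => y) = 0 := by
      intro j
      induction j using Nat.strong_induction_on with
      | _ j ih =>
        intro hj y
        refine IsBigO.continuousMultilinearMap_apply_eq_zero (p := p j) ?_ y
        -- The lower terms vanish by induction, so this difference is the degree j term alone.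
        have h1 := (hk.trans (mono (Nat.succ_le_succ hj))).sub (hO (j + 1))
        refine h1.congr_left fun z => ?_
        simp only [sub_sub_cancel, FormalMultilinearSeries.partialSum, Finset.sum_range_succ]
        rw [Finset.sum_eq_zero, zero_add]
        intro m hm
        exact ih m (Finset.mem_range.1 hm) ((Finset.mem_range.1 hm).le.trans hj) z
    intro j hj
    ext m
    rw [hp.iteratedFDeriv_eq_sum_of_completeSpace, ← (p j).iteratedFDeriv_comp_diagonal 0]
    have : (fun x : E => p j fun _ => x) = fun _ => (0 : F) := funext (diag j hj)
    rw [this]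
    cases j <;> simp
  · intro hj
    have diag : ∀ j ≤ k, ∀ y, p j (fun _ => y) = 0 := by
      intro j hjk y
      have := hp.factorial_smul y j
      rw [hj j hjk] at this
      rw [← Nat.cast_smul_eq_nsmul ℂ] at this
      exact (smul_eq_zero.1 this).resolve_left (by exact_mod_cast j.factorial_ne_zero)
    refine (hO (k + 1)).congr_left fun z => ?_
    rw [FormalMultilinearSeries.partialSum, Finset.sum_eq_zero, sub_zero]
    intro m hm
    exact diag m (Nat.lt_succ_iff.1 (Finset.mem_range.1 hm)) z

/-! ### Osculating spaces in terms of order of vanishing -/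

section Osc
theorem smul_mem_affineCone {ι : Type*} {X : Set (ℙ ℂ (ι → ℂ))} {w : ι → ℂ} (hw : w ∈ affineCone X) {a : ℂ}
    (ha : a ≠ 0) : a • w ∈ affineCone X := by
  obtain ⟨h0, h⟩ := hw
  refine ⟨smul_ne_zero ha h0, ?_⟩
  convert h using 1
  rw [Projectivization.mk_eq_mk_iff']
  exact ⟨a, rfl⟩

variable {ι : Type*} [Fintype ι] {d : ℕ} {X : Set (ℙ ℂ (ι → ℂ))} {x : ℙ ℂ (ι → ℂ)}

theorem IsLocalParam.eventually_mem_affineCone {F : (Fin d → ℂ) → ι → ℂ}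
    (hF : IsLocalParam d X x F) : ∀ᶠ v in 𝓝 0, F v ∈ affineCone X := by
  have h1 : ∀ᶠ q in 𝓝 ((1 : ℂ), (0 : Fin d → ℂ)), q.1 • F q.2 ∈ affineCone X := by
    have : affineCone X ∈ 𝓝[affineCone X] (F 0) := self_mem_nhdsWithin
    rw [← hF.image] at this
    exact this
  have h2 : Tendsto (fun v : Fin d → ℂ => ((1 : ℂ), v)) (𝓝 0) (𝓝 (1, 0)) :=
    Continuous.tendsto' (by fun_prop) _ _ rfl
  filter_upwards [h2.eventually h1] with v hv
  simpa using hv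

/-- By the immersion condition the cone map (c, u) ↦ c G(u) has injective derivative at (1, 0), so
near that point it cannot contract distances to the base point by more than a constant factor. -/
theorem IsLocalParam.isBigO_cone {G : (Fin d → ℂ) → ι → ℂ} (hG : IsLocalParam d X x G) :
    (fun q : ℂ × (Fin d → ℂ) => q - (1, 0)) =O[𝓝 (1, 0)] (fun q => q.1 • G q.2 - G 0) := by
  have hd : HasFDerivAt G (fderiv ℂ G 0) (0 : Fin d → ℂ) := hG.analytic.differentiableAt.hasFDerivAt
  have hd1 : HasFDerivAt (fun q : ℂ × (Fin d → ℂ) => G q.2)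
      ((fderiv ℂ G 0).comp (ContinuousLinearMap.snd ℂ ℂ (Fin d → ℂ))) ((1 : ℂ), (0 : Fin d → ℂ)) :=
    HasFDerivAt.comp (g := G) ((1 : ℂ), (0 : Fin d → ℂ)) hd hasFDerivAt_snd
  have hd2 := (hasFDerivAt_fst (𝕜 := ℂ) (p := ((1 : ℂ), (0 : Fin d → ℂ)))).smul hd1
  have hinj := fun (q : ℂ × (Fin d → ℂ)) hq => hG.immersion q.1 q.2 hq
  have hK := LinearMap.isClosedEmbedding_of_injective (f :=
    ((1 : ℂ) • (fderiv ℂ G 0).comp (ContinuousLinearMap.snd ℂ ℂ (Fin d → ℂ)) +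
      (ContinuousLinearMap.fst ℂ ℂ (Fin d → ℂ)).smulRight (G 0) :
        ℂ × (Fin d → ℂ) →L[ℂ] (ι → ℂ)).toLinearMap) (by
    rw [LinearMap.ker_eq_bot']
    intro q hq
    have := hinj q (by rw [← hq]; simp [add_comm])
    exact Prod.ext this.1 this.2)
  simpa using! (hd2.isTheta_sub hK.isInducing).isBigO_symm

/-- Order of vanishing does not depend on the parametrization. After rescaling, F(v) lies on the
cone near G(0), so it is a bounded multiple of some G(u) with ‖u‖ = O(‖v‖) by `isBigO_cone`. No
holomorphic change of coordinates has to be constructed. -/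
theorem IsLocalParam.isBigO_of_isBigO {F G : (Fin d → ℂ) → ι → ℂ} (hF : IsLocalParam d X x F)
    (hG : IsLocalParam d X x G) (ξ : (ι → ℂ) →L[ℂ] ℂ) (k : ℕ)
    (h : (fun v => ξ (G v)) =O[𝓝 0] (fun v => ‖v‖ ^ k)) :
    (fun v => ξ (F v)) =O[𝓝 0] (fun v => ‖v‖ ^ k) := by
  obtain ⟨hF0, hFx⟩ := hF.base
  obtain ⟨hG0, hGx⟩ := hG.base
  obtain ⟨a, ha⟩ := (Projectivization.mk_eq_mk_iff' ℂ _ _ hF0 hG0).1 (hFx.trans hGx.symm)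
  have ha0 : a ≠ 0 := by
    rintro rfl
    exact hF0 (by simpa using ha.symm)
  obtain ⟨K, hK0, hK⟩ := hG.isBigO_cone.exists_pos
  obtain ⟨M, hM0, hM⟩ := h.exists_pos
  have hFd : (fun v => F v - F 0) =O[𝓝 0] (fun v => v) := by
    simpa using hF.analytic.differentiableAt.isBigO_sub
  obtain ⟨K', hK'0, hK'⟩ := hFd.exists_pos
  have hU : ∀ᶠ q in 𝓝 ((1 : ℂ), (0 : Fin d → ℂ)), ‖q - (1, 0)‖ ≤ K * ‖q.1 • G q.2 - G 0‖ ∧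
      ‖ξ (G q.2)‖ ≤ M * ‖q.2‖ ^ k ∧ ‖q.1‖ ≤ 2 := by
    refine hK.bound.and (Eventually.and ?_ ?_)
    · have h2 : Tendsto (fun q : ℂ × (Fin d → ℂ) => q.2) (𝓝 (1, 0)) (𝓝 0) :=
        Continuous.tendsto' (by fun_prop) _ _ rfl
      simpa using h2.eventually hM.bound
    · have h2 : Tendsto (fun q : ℂ × (Fin d → ℂ) => ‖q.1‖) (𝓝 (1, 0)) (𝓝 1) :=
        Continuous.tendsto' (by fun_prop) _ _ (by simp)
      exact h2.eventually (eventually_le_nhds (by norm_num))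
  have hU' := image_mem_map (m := fun q : ℂ × (Fin d → ℂ) => q.1 • G q.2) hU
  rw [hG.image] at hU'
  have ht : Tendsto (fun v => a⁻¹ • F v) (𝓝 0) (𝓝[affineCone X] (G 0)) := by
    refine tendsto_nhdsWithin_iff.2 ⟨?_, ?_⟩
    · have := hF.analytic.continuousAt.tendsto.const_smul a⁻¹
      rwa [← ha, inv_smul_smul₀ ha0] at this
    · exact hF.eventually_mem_affineCone.mono fun v hv => smul_mem_affineCone hv (inv_ne_zero ha0)
  refine IsBigO.of_bound (‖a‖ * (2 * (M * (K * (‖a⁻¹‖ * K')) ^ k))) ?_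
  filter_upwards [ht hU', hK'.bound] with v hv hv'
  obtain ⟨q, ⟨hq1, hq2, hq3⟩, hq⟩ := hv
  simp only at hq
  have hFv : F v = a • q.1 • G q.2 := by rw [hq, smul_inv_smul₀ ha0]
  have hq4 : ‖q.2‖ ≤ K * (‖a⁻¹‖ * K') * ‖v‖ := by
    calc ‖q.2‖ ≤ ‖q - (1, 0)‖ := by
          have := norm_snd_le (q - (1, 0))
          rwa [Prod.snd_sub, sub_zero] at this
      _ ≤ K * ‖q.1 • G q.2 - G 0‖ := hq1
      _ = K * (‖a⁻¹‖ * ‖F v - F 0‖) := by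
        rw [hq, ← norm_smul, smul_sub, ← ha, inv_smul_smul₀ ha0]
      _ ≤ K * (‖a⁻¹‖ * (K' * ‖v‖)) := by gcongr
      _ = _ := by ring
  rw [hFv]
  simp only [map_smul, norm_smul, norm_pow, norm_norm]
  calc ‖a‖ * (‖q.1‖ * ‖ξ (G q.2)‖) ≤ ‖a‖ * (2 * (M * (K * (‖a⁻¹‖ * K') * ‖v‖) ^ k)) := by
        gcongr
        exact hq2.trans (by gcongr)
    _ = _ := by rw [mul_pow]; ring

/-- The osculating space is a span over all parametrizations; by `isBigO_of_isBigO`, testing one of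
them is enough. -/
theorem IsLocalParam.mem_dualAnnihilator_iff {F : (Fin d → ℂ) → ι → ℂ}
    (hF : IsLocalParam d X x F) (k : ℕ) (ξ : (ι → ℂ) →L[ℂ] ℂ) :
    (∀ w ∈ osculatingSpace k d X x, ξ w = 0) ↔
      (fun v => ξ (F v)) =O[𝓝 0] (fun v => ‖v‖ ^ (k + 1)) := by
  have key : ∀ F : (Fin d → ℂ) → ι → ℂ, AnalyticAt ℂ F 0 →
      ((fun v => ξ (F v)) =O[𝓝 0] (fun v => ‖v‖ ^ (k + 1)) ↔
        ∀ j ≤ k, ∀ m, ξ (iteratedFDeriv ℂ j F 0 m) = 0) := by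
    intro F hF
    rw [AnalyticAt.isBigO_pow_succ_iff (h := fun v => ξ (F v)) (ξ.analyticAt _ |>.comp hF)]
    refine forall₂_congr fun j _ => ?_
    have h2 := ξ.iteratedFDeriv_comp_left (hF.contDiffAt (n := ω)) (i := j) le_top
    rw [show (fun v => ξ (F v)) = ξ ∘ F from rfl, h2, ContinuousMultilinearMap.ext_iff]
    rfl
  constructor
  · intro h
    refine (key F hF.analytic).2 fun j hj m => h _ (Submodule.subset_span ⟨F, hF, j, hj, m, rfl⟩)
  · intro h w hw
    induction hw using Submodule.span_induction with
    | mem w hw =>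
      obtain ⟨F', hF', j, hj, m, rfl⟩ := hw
      exact (key F' hF'.analytic).1 (hF'.isBigO_of_isBigO hF ξ _ h) j hj m
    | zero => simp
    | add a b _ _ ha hb => simp [ha, hb]
    | smul c a _ ha => simp [ha]

end Osc

/-! ### Normalized local lifts of a projective curve -/

section Lift
variable {C : Type*} [TopologicalSpace C] {ι : Type*} [Fintype ι]

/-- In the local coordinate `e`, the map `f` is a holomorphic lift of the curve `φ`, normalized by
`x ∘ f = 1`, on which the function `y ∘ f` has no critical point. -/
structure IsLift (φ : C → ℙ ℂ (ι → ℂ)) (e : OpenPartialHomeomorph C ℂ) (f : ℂ → ι → ℂ)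
    (x y : (ι → ℂ) →L[ℂ] ℂ) : Prop where
  analyticAt : ∀ z ∈ e.target, AnalyticAt ℂ f z
  norm_eq : ∀ z ∈ e.target, x (f z) = 1
  deriv_ne : ∀ z ∈ e.target, y (deriv f z) ≠ 0
  submodule_eq : ∀ q ∈ e.source, (φ q).submodule = ℂ ∙ f (e q)

namespace IsLift
variable {φ : C → ℙ ℂ (ι → ℂ)} {e : OpenPartialHomeomorph C ℂ} {f : ℂ → ι → ℂ}
  {x y : (ι → ℂ) →L[ℂ] ℂ}

theorem ne_zero (h : IsLift φ e f x y) {z : ℂ} (hz : z ∈ e.target) : f z ≠ 0 := by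
  intro h0
  simpa [h0] using h.norm_eq z hz

theorem hasDerivAt (h : IsLift φ e f x y) {z : ℂ} (hz : z ∈ e.target) (η : (ι → ℂ) →L[ℂ] ℂ) :
    HasDerivAt (fun z => η (f z)) (η (deriv f z)) z :=
  η.hasFDerivAt.comp_hasDerivAt z (h.analyticAt z hz).differentiableAt.hasDerivAt

theorem norm_deriv (h : IsLift φ e f x y) {z : ℂ} (hz : z ∈ e.target) : x (deriv f z) = 0 := by
  have h1 := h.hasDerivAt hz x
  have h2 : (fun z => x (f z)) =ᶠ[𝓝 z] fun _ => 1 := by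
    filter_upwards [e.open_target.mem_nhds hz] with w hw using h.norm_eq w hw
  exact h1.unique ((hasDerivAt_const z (1 : ℂ)).congr_of_eventuallyEq h2)

theorem immersion (h : IsLift φ e f x y) {z : ℂ} (hz : z ∈ e.target) {a b : ℂ}
    (hab : a • f z + b • deriv f z = 0) : a = 0 ∧ b = 0 := by
  have ha : a = 0 := by simpa [h.norm_eq z hz, h.norm_deriv hz] using congrArg x hab
  subst ha
  refine ⟨rfl, ?_⟩
  simpa [h.deriv_ne z hz] using congrArg y hab

theorem analyticAt_apply (h : IsLift φ e f x y) {z : ℂ} (hz : z ∈ e.target)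
    (η : (ι → ℂ) →L[ℂ] ℂ) : AnalyticAt ℂ (fun z => η (f z)) z :=
  (η.analyticAt _).comp (h.analyticAt z hz)

theorem eq_smul_of_mem (h : IsLift φ e f x y) {q : C} (hq : q ∈ e.source) {w : ι → ℂ}
    (hw : w ∈ (φ q).submodule) : w = x w • f (e q) := by
  rw [h.submodule_eq q hq] at hw
  obtain ⟨a, rfl⟩ := Submodule.mem_span_singleton.1 hw
  simp [h.norm_eq _ (e.map_source hq)]

end IsLift

variable [ChartedSpace ℂ C]

/-- Divide a local lift g by a functional x nonzero on g(z₀). If y kills g(z₀) but not g′(z₀), the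
derivative of y∘g/x∘g at z₀ is y(g′)/x(g) ≠ 0. These conditions are open. -/
theorem IsProjEmbedding.exists_lift {φ : C → ℙ ℂ (ι → ℂ)} (hφ : IsProjEmbedding φ) (p : C) :
    ∃ (f : ℂ → ι → ℂ) (x y : (ι → ℂ) →L[ℂ] ℂ), ∀ᶠ q in 𝓝 p,
      AnalyticAt ℂ f (chartAt ℂ p q) ∧ x (f (chartAt ℂ p q)) = 1 ∧
      y (deriv f (chartAt ℂ p q)) ≠ 0 ∧ (φ q).submodule = ℂ ∙ f (chartAt ℂ p q) := by
  obtain ⟨F, hF, hφF, hli⟩ := hφ.2 p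
  set e := chartAt ℂ p with he
  set z0 := e p with hz0
  set g := F ∘ e.symm with hg
  have hpe : p ∈ e.source := mem_chart_source ℂ p
  have hgF : ∀ᶠ q in 𝓝 p, g (e q) = F q := by
    filter_upwards [e.open_source.mem_nhds hpe] with q hq
    simp [hg, e.left_inv hq]
  have hga : AnalyticAt ℂ g z0 := by
    have h1 := (contMDiffAt_iff.1 hF).2
    have h2 : ContDiffWithinAt ℂ ω g Set.univ z0 := by
      simpa [hg, hz0, he, Function.comp_def] using! h1
    exact (contDiffWithinAt_univ.1 h2).analyticAt
  have hg0 : g z0 = F p := hgF.self_of_nhds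
  rw [← hg0] at hli
  obtain ⟨hli1, hli2⟩ := LinearIndependent.pair_iff' (K := ℂ) (by simpa using hli.ne_zero 0) |>.1 hli
    |> fun h => (⟨by simpa using hli.ne_zero 0, h⟩ : g z0 ≠ 0 ∧ _)
  obtain ⟨x₀, hx₀, -⟩ := Submodule.exists_le_ker_of_notMem (K := ℂ) (p := ⊥) (v := g z0) (by simpa using hli1)
  obtain ⟨y₀, hy₀, hy₀'⟩ := Submodule.exists_le_ker_of_notMem (K := ℂ) (p := ℂ ∙ g z0)
    (v := deriv g z0) (by
      rw [Submodule.mem_span_singleton]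
      rintro ⟨a, ha⟩
      exact hli2 a ha)
  have hy₀'' : y₀ (g z0) = 0 := by
    simpa using hy₀' (Submodule.mem_span_singleton_self _)
  set x : (ι → ℂ) →L[ℂ] ℂ := LinearMap.toContinuousLinearMap x₀
  set y : (ι → ℂ) →L[ℂ] ℂ := LinearMap.toContinuousLinearMap y₀
  have hx : x (g z0) ≠ 0 := hx₀
  have hy : y (deriv g z0) ≠ 0 := hy₀
  have hy0 : y (g z0) = 0 := hy₀''
  set f : ℂ → ι → ℂ := fun z => (x (g z))⁻¹ • g z with hf
  have hxa : AnalyticAt ℂ (fun z => x (g z)) z0 := (x.analyticAt _).comp hga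
  have hfa : AnalyticAt ℂ f z0 := (hxa.inv hx).smul hga
  have hyf : y (deriv f z0) ≠ 0 := by
    have h1 := y.hasFDerivAt.comp_hasDerivAt z0 hfa.differentiableAt.hasDerivAt
    have h2 := (hxa.inv hx).differentiableAt.hasDerivAt.mul
      (y.hasFDerivAt.comp_hasDerivAt z0 hga.differentiableAt.hasDerivAt)
    have h3 := h1.unique (h2.congr_of_eventuallyEq (Eventually.of_forall fun z => by simp [hf]))
    rw [h3]
    simp [hy0, hx, hy]
  have hc : ContinuousAt e p := e.continuousAt hpe
  refine ⟨f, x, y, ?_⟩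
  have c1 := hc.eventually hfa.eventually_analyticAt
  have c2 := hc.eventually (hxa.continuousAt.eventually_ne hx)
  have c3 := hc.eventually ((y.continuous.continuousAt.comp hfa.deriv.continuousAt).eventually_ne hyf)
  filter_upwards [c1, c2, c3, hφF, hgF] with q h1 h2 h3 h4 h5
  obtain ⟨h0, h4⟩ := h4
  refine ⟨h1, by simp [hf, h2], h3, ?_⟩
  rw [h4, Projectivization.submodule_mk, ← h5, hf]
  exact (Submodule.span_singleton_smul_eq (IsUnit.mk0 _ (inv_ne_zero h2)) _).symm

/-- Near every point, finitely many embedded curves have lifts in a common local coordinate. -/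
theorem exists_common_lift {κ : Type*} [Finite κ] {ι : κ → Type*} [∀ i, Fintype (ι i)]
    [IsManifold 𝓘(ℂ, ℂ) ω C]
    {φ : ∀ i, C → ℙ ℂ (ι i → ℂ)} (hφ : ∀ i, IsProjEmbedding (φ i)) (p : C) :
    ∃ (e : OpenPartialHomeomorph C ℂ) (f : ∀ i, ℂ → ι i → ℂ) (x y : ∀ i, (ι i → ℂ) →L[ℂ] ℂ),
      p ∈ e.source ∧ (∀ q ∈ e.source, MDifferentiableAt 𝓘(ℂ, ℂ) 𝓘(ℂ, ℂ) e q) ∧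
      ∀ i, IsLift (φ i) e (f i) (x i) (y i) := by
  choose f x y h using fun i => (hφ i).exists_lift p
  obtain ⟨U, hU, hUo, hpU⟩ := eventually_nhds_iff.1 (eventually_all.2 h)
  refine ⟨(chartAt ℂ p).restrOpen U hUo, f, x, y, ⟨mem_chart_source ℂ p, hpU⟩, ?_, ?_⟩
  · rintro q ⟨hq, -⟩
    exact (mdifferentiableAt_atlas (chart_mem_atlas ℂ p) hq)
  · have key : ∀ z ∈ ((chartAt ℂ p).restrOpen U hUo).target, ∃ q ∈ U, chartAt ℂ p q = z := by
      intro z hz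
      refine ⟨((chartAt ℂ p).restrOpen U hUo).symm z, ?_,
        ((chartAt ℂ p).restrOpen U hUo).right_inv hz⟩
      exact (((chartAt ℂ p).restrOpen U hUo).map_target hz).2
    intro i
    refine ⟨?_, ?_, ?_, ?_⟩
    · intro z hz
      obtain ⟨q, hq, rfl⟩ := key z hz
      exact (hU q hq i).1
    · intro z hz
      obtain ⟨q, hq, rfl⟩ := key z hz
      exact (hU q hq i).2.1
    · intro z hz
      obtain ⟨q, hq, rfl⟩ := key z hz
      exact (hU q hq i).2.2.1
    · rintro q ⟨-, hq⟩
      exact (hU q hq i).2.2.2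

/-- No remote branch of the curve returns near φ p: for q outside the interior of V the vectors w₀
and F q are independent, an open condition in (w, q), and compactness makes it uniform in q. -/
theorem IsProjEmbedding.eventually_mem [CompactSpace C]
    {φ : C → ℙ ℂ (ι → ℂ)} (hφ : IsProjEmbedding φ) {p : C} {w₀ : ι → ℂ}
    (hw₀ : (φ p).submodule = ℂ ∙ w₀) {V : Set C} (hV : V ∈ 𝓝 p) :
    ∀ᶠ w in 𝓝 w₀, ∀ q, (φ q).submodule = ℂ ∙ w → q ∈ V := by
  have hw₀0 : w₀ ≠ 0 := by
    rintro rfl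
    have h1 := (φ p).finrank_submodule
    rw [hw₀, Submodule.span_zero_singleton, finrank_bot] at h1
    exact zero_ne_one h1
  have hK : IsCompact (interior V)ᶜ := isOpen_interior.isClosed_compl.isCompact
  have := hK.eventually_forall_of_forall_eventually (x₀ := w₀)
    (P := fun w q => (φ q).submodule ≠ ℂ ∙ w) ?_
  · filter_upwards [this] with w hw q hq
    by_contra hqV
    exact hw q (fun h => hqV (interior_subset h)) hq
  · intro q hq
    have hqp : q ≠ p := by
      rintro rfl
      exact hq (mem_interior_iff_mem_nhds.2 hV)
    obtain ⟨F, hF, hφF, -⟩ := hφ.2 q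
    obtain ⟨hFq0, hFq⟩ := hφF.self_of_nhds
    have hli : LinearIndependent ℂ ![w₀, F q] := by
      rw [LinearIndependent.pair_iff' hw₀0]
      intro a ha
      apply hqp
      apply hφ.1
      apply Projectivization.submodule_injective
      rw [hw₀, hFq, Projectivization.submodule_mk, ← ha]
      refine Submodule.span_singleton_smul_eq (IsUnit.mk0 _ ?_) _
      rintro rfl
      exact hFq0 (by simpa using ha.symm)
    have hc : ContinuousAt (fun z : (ι → ℂ) × C => (![z.1, F z.2] : Fin 2 → ι → ℂ)) (w₀, q) := by
      refine continuousAt_pi.2 fun i => ?_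
      fin_cases i
      · exact continuousAt_fst
      · exact ContinuousAt.comp (f := Prod.snd) (g := F) hF.continuousAt continuousAt_snd
    have h1 := hc.eventually (isOpen_setOfPred_linearIndependent.mem_nhds hli)
    have h2 : ∀ᶠ z : (ι → ℂ) × C in 𝓝 (w₀, q), ∃ h : F z.2 ≠ 0,
        φ z.2 = Projectivization.mk ℂ (F z.2) h :=
      (continuousAt_snd (p := (w₀, q))).eventually hφF
    filter_upwards [h1, h2] with z hz1 hz2 hz3
    obtain ⟨h0, hz2⟩ := hz2
    rw [hz2, Projectivization.submodule_mk] at hz3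
    have hz1 : LinearIndependent ℂ ![z.1, F z.2] := hz1
    have hm : F z.2 ∈ ℂ ∙ z.1 := hz3 ▸ Submodule.mem_span_singleton_self _
    obtain ⟨a, ha⟩ := Submodule.mem_span_singleton.1 hm
    exact (LinearIndependent.pair_iff' (by simpa using hz1.ne_zero 0)).1 hz1 a ha

end Lift

/-! ### Sections of filter maps and points of affine cones -/

theorem Filter.le_map_of_section {α β : Type*} {l : Filter α} {m : Filter β} {Γ : β → α} {s : α → β}
    (hs : Tendsto s l m) (h : ∀ᶠ w in l, Γ (s w) = w) : l ≤ map Γ m :=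
  calc l = map (Γ ∘ s) l := by rw [map_congr (m₁ := Γ ∘ s) (m₂ := id) h, map_id]
    _ = map Γ (map s l) := (Filter.map_map).symm
    _ ≤ map Γ m := map_mono hs

theorem mem_affineCone_iff {ι : Type*} {X : Set (ℙ ℂ (ι → ℂ))} {w : ι → ℂ} :
    w ∈ affineCone X ↔ w ≠ 0 ∧ ∃ x ∈ X, x.submodule = ℂ ∙ w := by
  constructor
  · rintro ⟨h0, h⟩
    exact ⟨h0, _, h, Projectivization.submodule_mk _ _⟩
  · rintro ⟨h0, x, hx, hxw⟩
    refine ⟨h0, ?_⟩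
    convert hx
    apply Projectivization.submodule_injective
    rw [hxw, Projectivization.submodule_mk]

/-! ### Osculating spaces of curves -/

section Curve
variable {C : Type*} [TopologicalSpace C] {ι : Type*} [Fintype ι] [ChartedSpace ℂ C]
  [CompactSpace C] {φ : C → ℙ ℂ (ι → ℂ)} {e : OpenPartialHomeomorph C ℂ} {f : ℂ → ι → ℂ}
  {x y : (ι → ℂ) →L[ℂ] ℂ}

theorem IsLift.isLocalParam (h : IsLift φ e f x y) (hφ : IsProjEmbedding φ) {q : C}
    (hq : q ∈ e.source) : IsLocalParam 1 (Set.range φ) (φ q) (fun v => f (e q + v 0)) := by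
  have hz := e.map_source hq
  set z₀ := e q with hz₀
  have hfa := h.analyticAt z₀ hz
  have hpr : AnalyticAt ℂ (fun v : Fin 1 → ℂ => z₀ + v 0) 0 :=
    analyticAt_const.add ((ContinuousLinearMap.proj (R := ℂ) (φ := fun _ : Fin 1 => ℂ) 0).analyticAt 0)
  have hFa : AnalyticAt ℂ (fun v : Fin 1 → ℂ => f (z₀ + v 0)) 0 :=
    AnalyticAt.fun_comp (by simpa using hfa) hpr
  refine ⟨hFa, ⟨by simpa using h.ne_zero hz, ?_⟩, ?_, ?_⟩
  · apply Projectivization.submodule_injective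
    simp [Projectivization.submodule_mk, h.submodule_eq q hq, hz₀]
  · intro c v hcv
    have h1 : HasFDerivAt (fun v : Fin 1 → ℂ => z₀ + v 0)
        (ContinuousLinearMap.proj (R := ℂ) (φ := fun _ : Fin 1 => ℂ) 0) 0 :=
      (ContinuousLinearMap.proj (R := ℂ) (φ := fun _ : Fin 1 => ℂ) 0).hasFDerivAt.const_add z₀
    have h2 : HasDerivAt f (deriv f z₀) (z₀ + (0 : Fin 1 → ℂ) 0) := by
      simpa using hfa.differentiableAt.hasDerivAt
    have h3 := h2.hasFDerivAt.comp (0 : Fin 1 → ℂ) h1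
    have h4 : fderiv ℂ (fun v : Fin 1 → ℂ => f (z₀ + v 0)) 0 v = v 0 • deriv f z₀ := by
      rw [show (fun v : Fin 1 → ℂ => f (z₀ + v 0)) = f ∘ (fun v : Fin 1 → ℂ => z₀ + v 0) from rfl,
        h3.fderiv]
      simp
    rw [h4] at hcv
    have := h.immersion hz (a := c) (b := v 0) (by simpa using hcv)
    refine ⟨this.1, ?_⟩
    ext i
    fin_cases i
    exact this.2
  · apply le_antisymm
    · refine tendsto_nhdsWithin_iff.2 ⟨?_, ?_⟩
      · have : ContinuousAt (fun q : ℂ × (Fin 1 → ℂ) => q.1 • f (z₀ + q.2 0)) (1, 0) :=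
          continuousAt_fst.smul (ContinuousAt.comp (f := Prod.snd)
            (g := fun v : Fin 1 → ℂ => f (z₀ + v 0)) hFa.continuousAt continuousAt_snd)
        simpa [ContinuousAt] using this
      · have h1 : ContinuousAt (fun q : ℂ × (Fin 1 → ℂ) => z₀ + q.2 0) (1, 0) := by fun_prop
        have h2 := h1.eventually (e.open_target.mem_nhds (by simpa using hz))
        have h3 : ContinuousAt (fun q : ℂ × (Fin 1 → ℂ) => q.1) (1, 0) := continuousAt_fst
        have h4 := h3.eventually_ne one_ne_zero
        filter_upwards [h2, h4] with p hp1 hp2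
        refine smul_mem_affineCone (mem_affineCone_iff.2 ⟨h.ne_zero hp1, _,
          Set.mem_range_self (e.symm (z₀ + p.2 0)), ?_⟩) hp2
        rw [h.submodule_eq _ (e.map_target hp1), e.right_inv hp1]
    -- Local surjectivity onto the cone: P picks the curve point under w and tends to q by
    -- `eventually_mem`, and the scalar is x w because x∘f = 1.
    · have hch : ∀ w, ∃ p, w ∈ affineCone (Set.range φ) → (φ p).submodule = ℂ ∙ w := by
        intro w
        by_cases hw : w ∈ affineCone (Set.range φ)
        · obtain ⟨-, _, ⟨p, rfl⟩, hp⟩ := mem_affineCone_iff.1 hw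
          exact ⟨p, fun _ => hp⟩
        · exact ⟨q, fun h => absurd h hw⟩
      choose P hP using hch
      have hPt : Tendsto P (𝓝[affineCone (Set.range φ)] (f z₀)) (𝓝 q) := by
        refine tendsto_def.2 fun V hV => ?_
        have := hφ.eventually_mem (h.submodule_eq q hq) hV
        filter_upwards [nhdsWithin_le_nhds this, self_mem_nhdsWithin] with w hw hwc
        exact hw _ (hP w hwc)
      have he : Tendsto (fun w => e (P w)) (𝓝[affineCone (Set.range φ)] (f z₀)) (𝓝 z₀) :=
        (e.continuousAt hq).tendsto.comp hPt
      simp only [Pi.zero_apply, add_zero]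
      refine Filter.le_map_of_section (s := fun w => (x w, fun _ => e (P w) - z₀)) ?_ ?_
      · refine Tendsto.prodMk_nhds ?_ ?_
        · rw [← h.norm_eq z₀ hz]
          exact (x.continuous.tendsto _).mono_left nhdsWithin_le_nhds
        · refine tendsto_pi_nhds.2 fun _ => ?_
          simpa using he.sub_const z₀
      · filter_upwards [self_mem_nhdsWithin, hPt (e.open_source.mem_nhds hq)] with w hw1 hw2
        simp only [add_sub_cancel]
        refine (h.eq_smul_of_mem hw2 ?_).symm
        rw [hP w hw1]
        exact Submodule.mem_span_singleton_self _

theorem IsLift.mem_dualAnnihilator_iff (h : IsLift φ e f x y) (hφ : IsProjEmbedding φ) {q : C}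
    (hq : q ∈ e.source) (k : ℕ) (η : (ι → ℂ) →L[ℂ] ℂ) :
    (∀ w ∈ osculatingSpace k 1 (Set.range φ) (φ q), η w = 0) ↔
      (fun z => η (f z)) =O[𝓝 (e q)] (fun z => (z - e q) ^ (k + 1)) := by
  rw [(h.isLocalParam hφ hq).mem_dualAnnihilator_iff]
  constructor
  · intro hO
    have ht : Tendsto (fun z : ℂ => (fun _ : Fin 1 => z - e q)) (𝓝 (e q)) (𝓝 0) :=
      Continuous.tendsto' (by fun_prop) _ _ (by ext; simp)
    refine ((hO.comp_tendsto ht).congr_left fun z => by simp).trans ?_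
    exact IsBigO.of_bound 1 (Eventually.of_forall fun z => by simp)
  · intro hO
    have ht : Tendsto (fun v : Fin 1 → ℂ => e q + v 0) (𝓝 0) (𝓝 (e q)) :=
      Continuous.tendsto' (by fun_prop) _ _ (by simp)
    refine (hO.comp_tendsto ht).trans ?_
    refine IsBigO.of_bound 1 (Eventually.of_forall fun v => ?_)
    simp only [Function.comp_apply, add_sub_cancel_left, norm_pow, norm_norm, one_mul]
    exact pow_le_pow_left₀ (norm_nonneg _) (norm_le_pi_norm v 0) _

end Curve

/-! ### The blocks of homogeneous coordinates -/

section Blocks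
variable {n : ℕ} (r : Fin n → ℕ)

/-- The block of homogeneous coordinates of index `i`. -/
def blockProj (i : Fin n) : (ScrollIdx r → ℂ) →ₗ[ℂ] (Fin (r i + 1) → ℂ) :=
  LinearMap.funLeft ℂ ℂ (fun k : Fin (r i + 1) => (⟨i, k⟩ : ScrollIdx r))

variable {r}

@[simp] theorem blockProj_apply (i : Fin n) (w : ScrollIdx r → ℂ) (k : Fin (r i + 1)) :
    blockProj r i w k = w ⟨i, k⟩ := rfl

theorem blockIncl_apply_same (i : Fin n) (v : Fin (r i + 1) → ℂ) (k : Fin (r i + 1)) :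
    blockIncl r i v ⟨i, k⟩ = v k := by
  have hinj : Function.Injective (fun k : Fin (r i + 1) => (⟨i, k⟩ : ScrollIdx r)) :=
    fun a b hab => by simpa using hab
  exact hinj.extend_apply v 0 k

theorem blockIncl_apply_of_ne {i i' : Fin n} (h : i' ≠ i) (v : Fin (r i + 1) → ℂ)
    (k : Fin (r i' + 1)) : blockIncl r i v ⟨i', k⟩ = 0 := by
  refine Function.extend_apply' _ _ _ ?_
  rintro ⟨k', hk'⟩
  exact h (congrArg Sigma.fst hk').symm

@[simp] theorem blockProj_blockIncl (i : Fin n) (v : Fin (r i + 1) → ℂ) :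
    blockProj r i (blockIncl r i v) = v := by
  ext k
  exact blockIncl_apply_same i v k

theorem blockProj_blockIncl_of_ne {i i' : Fin n} (h : i' ≠ i) (v : Fin (r i + 1) → ℂ) :
    blockProj r i' (blockIncl r i v) = 0 := by
  ext k
  exact blockIncl_apply_of_ne h v k

theorem blockProj_ext {w w' : ScrollIdx r → ℂ} (h : ∀ i, blockProj r i w = blockProj r i w') :
    w = w' := by
  ext ⟨i, k⟩
  exact congrFun (h i) k

theorem blockProj_sum_blockIncl (g : ∀ i, Fin (r i + 1) → ℂ) (i : Fin n) :
    blockProj r i (∑ j, blockIncl r j (g j)) = g i := by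
  rw [map_sum, Finset.sum_eq_single i]
  · simp
  · intro j _ hj
    exact blockProj_blockIncl_of_ne hj.symm _
  · simp

theorem sum_blockIncl_blockProj (w : ScrollIdx r → ℂ) :
    ∑ i, blockIncl r i (blockProj r i w) = w :=
  blockProj_ext fun i => blockProj_sum_blockIncl _ i

theorem mem_iSup_map_blockIncl {S : Finset (Fin n)} {T : ∀ i, Submodule ℂ (Fin (r i + 1) → ℂ)}
    {w : ScrollIdx r → ℂ} :
    w ∈ ⨆ i ∈ S, (T i).map (blockIncl r i) ↔
      ∀ i, blockProj r i w ∈ T i ∧ (i ∉ S → blockProj r i w = 0) := by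
  constructor
  · intro hw i
    have h1 : ⨆ i ∈ S, (T i).map (blockIncl r i) ≤ (T i).comap (blockProj r i) := by
      refine iSup₂_le fun j _ => ?_
      rintro _ ⟨v, hv, rfl⟩
      rw [Submodule.mem_comap]
      rcases eq_or_ne i j with rfl | h
      · simpa using hv
      · rw [blockProj_blockIncl_of_ne h]
        exact zero_mem _
    refine ⟨h1 hw, fun hi => ?_⟩
    have h2 : ⨆ i ∈ S, (T i).map (blockIncl r i) ≤ LinearMap.ker (blockProj r i) := by
      refine iSup₂_le fun j hj => ?_
      rintro _ ⟨v, hv, rfl⟩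
      rw [LinearMap.mem_ker]
      exact blockProj_blockIncl_of_ne (by rintro rfl; exact hi hj) _
    exact h2 hw
  · intro h
    rw [← sum_blockIncl_blockProj w]
    refine Submodule.sum_mem _ fun i _ => ?_
    by_cases hi : i ∈ S
    · exact Submodule.mem_iSup_of_mem i (Submodule.mem_iSup_of_mem hi
        (Submodule.mem_map_of_mem (h i).1))
    · rw [(h i).2 hi, map_zero]
      exact zero_mem _

variable {C : Type*} {φ : ∀ i, C → ℙ ℂ (Fin (r i + 1) → ℂ)}

theorem mem_fibreSpan_iff {S : Finset (Fin n)} {p : C} {w : ScrollIdx r → ℂ} :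
    w ∈ fibreSpan φ S p ↔
      ∀ i, blockProj r i w ∈ (φ i p).submodule ∧ (i ∉ S → blockProj r i w = 0) :=
  mem_iSup_map_blockIncl

theorem mem_affineCone_decomposableScroll {w : ScrollIdx r → ℂ} :
    w ∈ affineCone (decomposableScroll φ) ↔
      w ≠ 0 ∧ ∃ p, ∀ i, blockProj r i w ∈ (φ i p).submodule := by
  rw [mem_affineCone_iff]
  refine and_congr_right fun h0 => ?_
  have key : ∀ p, w ∈ fibreSpan φ Finset.univ p ↔ ∀ i, blockProj r i w ∈ (φ i p).submodule := by
    intro p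
    simp [mem_fibreSpan_iff]
  constructor
  · rintro ⟨x, hx, hxw⟩
    obtain ⟨p, hp⟩ := Set.mem_iUnion.1 hx
    refine ⟨p, (key p).1 (hp ?_)⟩
    rw [hxw]
    exact Submodule.mem_span_singleton_self _
  · rintro ⟨p, hp⟩
    refine ⟨Projectivization.mk ℂ w h0, Set.mem_iUnion.2 ⟨p, ?_⟩, Projectivization.submodule_mk _ _⟩
    rw [linearSubspace, Set.mem_ofPred_eq, Projectivization.submodule_mk,
      Submodule.span_singleton_le_iff_mem, key]
    exact hp

end Blocks

/-! ### Orders of vanishing along a scroll -/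

/-- Needed after dividing by z - z₀, which gives estimates only off z₀. Since k ≠ 0, continuity
forces h z₀ = 0. -/
theorem isBigO_nhds_of_isBigO_punctured {h : ℂ → ℂ} {z₀ : ℂ} {k : ℕ} (hk : k ≠ 0)
    (hc : ContinuousAt h z₀) (hO : h =O[𝓝[≠] z₀] fun z => (z - z₀) ^ k) :
    h =O[𝓝 z₀] fun z => (z - z₀) ^ k := by
  have h0 : h z₀ = 0 := by
    have h1 : Tendsto (fun z => (z - z₀) ^ k) (𝓝[≠] z₀) (𝓝 0) :=
      (Continuous.tendsto' (by fun_prop) _ _ (by simp [hk])).mono_left nhdsWithin_le_nhds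
    exact tendsto_nhds_unique (hc.tendsto.mono_left nhdsWithin_le_nhds) (hO.trans_tendsto h1)
  rw [← nhdsNE_sup_pure]
  refine hO.sup ?_
  refine IsBigO.of_bound 1 ?_
  simp [h0]

/-- Restrict to lines u = (z - z₀) m with m_j = 1. Direction e_j leaves Σ c_i h_i; adding e_i
contributes (z - z₀) h_i, so h_i has order 2 for i ≠ j. Conversely each u_i h_i is a product of
orders 1 and 2. -/
theorem isBigO_scroll_iff {n : ℕ} {c : Fin n → ℂ} {j : Fin n} (hj : c j ≠ 0) {h : Fin n → ℂ → ℂ}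
    {z₀ : ℂ} (hc : ∀ i, ContinuousAt (h i) z₀) :
    (fun u : Fin n → ℂ => ∑ i, (c i + if i = j then 0 else u i) * h i (z₀ + u j)) =O[𝓝 0]
        (fun u => ‖u‖ ^ 3) ↔
      (∀ i, h i =O[𝓝 z₀] fun z => (z - z₀) ^ 2) ∧
        (fun z => ∑ i, c i * h i z) =O[𝓝 z₀] fun z => (z - z₀) ^ 3 := by
  constructor
  · intro hO
    have key : ∀ m : Fin n → ℂ, m j = 1 → (fun z => ∑ i, (c i + if i = j then 0 else (z - z₀) * m i) * h i z)
        =O[𝓝 z₀] fun z => (z - z₀) ^ 3 := by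
      intro m hm
      have ht : Tendsto (fun z : ℂ => (z - z₀) • m) (𝓝 z₀) (𝓝 0) :=
        Continuous.tendsto' (by fun_prop) _ _ (by simp)
      refine ((hO.comp_tendsto ht).congr_left fun z => by simp [hm]).trans ?_
      refine IsBigO.of_bound (‖m‖ ^ 3) (Eventually.of_forall fun z => ?_)
      simp [norm_smul, mul_pow, mul_comm]
    have h3 : (fun z => ∑ i, c i * h i z) =O[𝓝 z₀] fun z => (z - z₀) ^ 3 := by
      refine (key (Pi.single j 1) (by simp)).congr_left fun z => ?_
      refine Finset.sum_congr rfl fun i _ => ?_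
      by_cases hi : i = j <;> simp [hi]
    have pow32 : (fun z => (z - z₀) ^ 3) =O[𝓝 z₀] fun z => (z - z₀) ^ 2 := by
      have h1 : (fun z => z - z₀) =O[𝓝 z₀] fun _ => (1 : ℂ) :=
        Tendsto.isBigO_one ℂ (c := 0) (Continuous.tendsto' (by fun_prop) _ _ (by simp))
      refine ((isBigO_refl (fun z => (z - z₀) ^ 2) (𝓝 z₀)).mul h1).congr (fun z => by ring)
        fun z => by ring
    have h2 : ∀ i, i ≠ j → h i =O[𝓝 z₀] fun z => (z - z₀) ^ 2 := by
      intro i hi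
      refine isBigO_nhds_of_isBigO_punctured two_ne_zero (hc i) ?_
      have h4 := (key (Pi.single j 1 + Pi.single i 1) (by simp [hi.symm])).sub h3
      have h5 : (fun z => (z - z₀) * h i z) =O[𝓝 z₀] fun z => (z - z₀) ^ 3 := by
        refine h4.congr_left fun z => ?_
        rw [← Finset.sum_sub_distrib, Finset.sum_eq_single i]
        · simp [hi]; ring
        · intro b _ hb
          by_cases hbj : b = j <;> simp [hbj, hb]
        · simp
      have h6 := (isBigO_refl (fun z => (z - z₀)⁻¹) (𝓝[≠] z₀)).mul (h5.mono nhdsWithin_le_nhds)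
      refine h6.congr' ?_ ?_
      · filter_upwards [self_mem_nhdsWithin] with z hz
        have : z - z₀ ≠ 0 := sub_ne_zero.2 hz
        field_simp
      · filter_upwards [self_mem_nhdsWithin] with z hz
        have : z - z₀ ≠ 0 := sub_ne_zero.2 hz
        field_simp
    refine ⟨fun i => ?_, h3⟩
    rcases eq_or_ne i j with rfl | hi
    -- Block j has no coefficient parameter; h_j is obtained from the full sum by removing the other
    -- terms and dividing by c_j.
    · have h4 : (fun z => ∑ k ∈ Finset.univ.erase i, c k * h k z) =O[𝓝 z₀] fun z => (z - z₀) ^ 2 :=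
        IsBigO.fun_sum fun k hk => (h2 k (Finset.ne_of_mem_erase hk)).const_mul_left _
      refine ((((h3.trans pow32).sub h4)).const_mul_left (c i)⁻¹).congr_left fun z => ?_
      rw [← Finset.add_sum_erase _ _ (Finset.mem_univ i)]
      field_simp
      ring
    · exact h2 i hi
  · rintro ⟨h2, h3⟩
    have ht : Tendsto (fun u : Fin n → ℂ => z₀ + u j) (𝓝 0) (𝓝 z₀) :=
      Continuous.tendsto' (by fun_prop) _ _ (by simp)
    have hpow : ∀ k, (fun u : Fin n → ℂ => ((z₀ + u j) - z₀) ^ k) =O[𝓝 0] fun u => ‖u‖ ^ k := by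
      intro k
      refine IsBigO.of_bound 1 (Eventually.of_forall fun u => ?_)
      simp only [add_sub_cancel_left, norm_pow, norm_norm, one_mul]
      exact pow_le_pow_left₀ (norm_nonneg _) (norm_le_pi_norm u j) _
    have a1 := (h3.comp_tendsto ht).trans (hpow 3)
    have a2 : ∀ i, (fun u : Fin n → ℂ => (if i = j then 0 else u i) * h i (z₀ + u j)) =O[𝓝 0]
        fun u => ‖u‖ ^ 3 := by
      intro i
      have b1 : (fun u : Fin n → ℂ => if i = j then 0 else u i) =O[𝓝 0] fun u => ‖u‖ := by
        refine IsBigO.of_bound 1 (Eventually.of_forall fun u => ?_)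
        split_ifs
        · simp
        · simpa using norm_le_pi_norm u i
      refine (b1.mul (((h2 i).comp_tendsto ht).trans (hpow 2))).congr_right fun u => by ring
    refine (a1.add (IsBigO.fun_sum (s := Finset.univ) fun i _ => a2 i)).congr_left fun u => ?_
    simp only [Function.comp_apply, ← Finset.sum_add_distrib, add_mul]

/-! ### Osculating spaces of decomposable scrolls -/

section Scroll
variable {n : ℕ} {r : Fin n → ℕ}

/-- The vector with blocks `b i • g i`. -/
def blockComb (b : Fin n → ℂ) (g : ∀ i, Fin (r i + 1) → ℂ) : ScrollIdx r → ℂ :=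
  fun a => b a.1 * g a.1 a.2

@[simp] theorem blockProj_blockComb (b : Fin n → ℂ) (g : ∀ i, Fin (r i + 1) → ℂ) (i : Fin n) :
    blockProj r i (blockComb b g) = b i • g i := rfl

theorem blockComb_eq_sum (b : Fin n → ℂ) (g : ∀ i, Fin (r i + 1) → ℂ) :
    blockComb b g = ∑ i, b i • blockIncl r i (g i) := by
  conv_lhs => rw [← sum_blockIncl_blockProj (blockComb b g)]
  simp

variable {C : Type*} [TopologicalSpace C] [ChartedSpace ℂ C] [CompactSpace C]
  {φ : ∀ i, C → ℙ ℂ (Fin (r i + 1) → ℂ)} {e : OpenPartialHomeomorph C ℂ}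
  {f : ∀ i, ℂ → Fin (r i + 1) → ℂ} {x y : ∀ i, (Fin (r i + 1) → ℂ) →L[ℂ] ℂ}

/-- Keeping the coefficient of block j at c_j ≠ 0 removes the homogeneous scaling, and the freed
variable u_j serves as the coordinate on C. -/
theorem isLocalParam_scroll (hL : ∀ i, IsLift (φ i) e (f i) (x i) (y i))
    (hφ : ∀ i, IsProjEmbedding (φ i)) {q : C} (hq : q ∈ e.source) {c : Fin n → ℂ} {j : Fin n}
    (hj : c j ≠ 0) {X : ℙ ℂ (ScrollIdx r → ℂ)}
    (hX : X.submodule = ℂ ∙ blockComb c (fun i => f i (e q))) :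
    IsLocalParam n (decomposableScroll φ) X
      (fun u => blockComb (fun i => c i + if i = j then 0 else u i) (fun i => f i (e q + u j))) := by
  have hz := e.map_source hq
  set z₀ := e q with hz₀
  have hfa := fun i => (hL i).analyticAt z₀ hz
  set m : Fin n → (Fin n → ℂ) →L[ℂ] ℂ := fun i =>
    if i = j then 0 else ContinuousLinearMap.proj (R := ℂ) (φ := fun _ : Fin n => ℂ) i with hm
  have hmv : ∀ i v, m i v = if i = j then 0 else v i := by
    intro i v
    by_cases hi : i = j <;> simp [hm, hi]
  set G : (Fin n → ℂ) → ScrollIdx r → ℂ := fun u =>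
    blockComb (fun i => c i + if i = j then 0 else u i) (fun i => f i (z₀ + u j)) with hG
  have hG0 : G 0 = blockComb c (fun i => f i z₀) := by
    rw [hG]
    ext a
    simp [blockComb]
  have hpr : AnalyticAt ℂ (fun v : Fin n → ℂ => z₀ + v j) 0 :=
    analyticAt_const.add
      ((ContinuousLinearMap.proj (R := ℂ) (φ := fun _ : Fin n => ℂ) j).analyticAt 0)
  have hfpr : ∀ i, AnalyticAt ℂ (fun v : Fin n → ℂ => f i (z₀ + v j)) 0 := fun i =>
    AnalyticAt.fun_comp (by simpa using hfa i) hpr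
  have hGa : AnalyticAt ℂ G 0 := by
    refine AnalyticAt.pi fun a => ?_
    have h1 : AnalyticAt ℂ (fun v : Fin n → ℂ => c a.1 + m a.1 v) 0 :=
      analyticAt_const.add ((m a.1).analyticAt 0)
    have h2 : AnalyticAt ℂ (fun v : Fin n → ℂ => f a.1 (z₀ + v j) a.2) 0 :=
      ((ContinuousLinearMap.proj (R := ℂ) (φ := fun _ : Fin (r a.1 + 1) => ℂ) a.2).analyticAt
        _).comp (hfpr a.1)
    simpa [hG, blockComb, hmv] using! h1.mul h2
  have hG0' : G 0 ≠ 0 := by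
    intro h0
    have := congrArg (blockProj r j) h0
    rw [hG0, blockProj_blockComb, map_zero] at this
    exact smul_ne_zero hj ((hL j).ne_zero hz) this
  refine ⟨hGa, ⟨hG0', ?_⟩, ?_, ?_⟩
  · apply Projectivization.submodule_injective
    rw [Projectivization.submodule_mk, hG0, hX]
  · intro a v hav
    have key : ∀ i, blockProj r i (fderiv ℂ G 0 v) =
        (m i v) • f i z₀ + (c i * v j) • deriv (f i) z₀ := by
      intro i
      have h1 : HasFDerivAt (fun v : Fin n → ℂ => z₀ + v j)
          (ContinuousLinearMap.proj (R := ℂ) (φ := fun _ : Fin n => ℂ) j) 0 :=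
        (ContinuousLinearMap.proj (R := ℂ) (φ := fun _ : Fin n => ℂ) j).hasFDerivAt.const_add z₀
      have h2 : HasDerivAt (f i) (deriv (f i) z₀) (z₀ + (0 : Fin n → ℂ) j) := by
        simpa using (hfa i).differentiableAt.hasDerivAt
      have h3 := h2.hasFDerivAt.comp (0 : Fin n → ℂ) h1
      have h4 := ((m i).hasFDerivAt (x := 0)).const_add (c i)
      have h5 := h4.smul h3
      have h6 := (LinearMap.toContinuousLinearMap (blockProj r i)).hasFDerivAt.comp (0 : Fin n → ℂ)
        hGa.differentiableAt.hasFDerivAt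
      have h7 := h6.unique (h5.congr_of_eventuallyEq (Eventually.of_forall fun u => by
        simp [hG, hmv]))
      have h8 := congrArg (fun L => L v) h7
      simp only [ContinuousLinearMap.comp_apply, LinearMap.coe_toContinuousLinearMap'] at h8
      rw [h8]
      simp [add_comm, mul_smul]
    have hb : ∀ i, (a * c i + m i v) • f i z₀ + (c i * v j) • deriv (f i) z₀ = 0 := by
      intro i
      have h1 := congrArg (blockProj r i) hav
      rw [hG0, map_add, map_smul, blockProj_blockComb, key, map_zero, ← add_assoc, smul_smul,
        ← add_smul] at h1
      exact h1
    -- In block j the coefficient is constant, so this yields a = 0 and v_j = 0; the other blocks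
    -- then give v_i = 0.
    have hbj := (hL j).immersion hz (hb j)
    have ha : a = 0 := by simpa [hmv, hj] using hbj.1
    refine ⟨ha, ?_⟩
    ext i
    rcases eq_or_ne i j with rfl | hi
    · simpa [hj] using hbj.2
    · have := ((hL i).immersion hz (hb i)).1
      simpa [ha, hmv, hi] using this
  · apply le_antisymm
    · refine tendsto_nhdsWithin_iff.2 ⟨?_, ?_⟩
      · have : ContinuousAt (fun q : ℂ × (Fin n → ℂ) => q.1 • G q.2) (1, 0) :=
          continuousAt_fst.smul (ContinuousAt.comp (f := Prod.snd)
            (g := G) hGa.continuousAt continuousAt_snd)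
        simpa [ContinuousAt] using this
      · have h1 : ContinuousAt (fun q : ℂ × (Fin n → ℂ) => z₀ + q.2 j) (1, 0) := by fun_prop
        have h2 := h1.eventually (e.open_target.mem_nhds (by simpa using hz))
        have h3 : ContinuousAt (fun q : ℂ × (Fin n → ℂ) => q.1) (1, 0) := continuousAt_fst
        have h4 := h3.eventually_ne one_ne_zero
        filter_upwards [h2, h4] with p hp1 hp2
        refine smul_mem_affineCone (mem_affineCone_decomposableScroll.2
          ⟨?_, e.symm (z₀ + p.2 j), ?_⟩) hp2
        · intro h0
          have := congrArg (blockProj r j) h0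
          rw [hG, blockProj_blockComb, map_zero] at this
          exact smul_ne_zero (by simpa using hj) ((hL j).ne_zero hp1) this
        · intro i
          rw [hG, blockProj_blockComb, (hL i).submodule_eq _ (e.map_target hp1), e.right_inv hp1]
          exact Submodule.smul_mem _ _ (Submodule.mem_span_singleton_self _)
    · set K := affineCone (decomposableScroll φ)
      have hch : ∀ w, ∃ p, w ∈ K → ∀ i, blockProj r i w ∈ (φ i p).submodule := by
        intro w
        by_cases hw : w ∈ K
        · obtain ⟨-, p, hp⟩ := mem_affineCone_decomposableScroll.1 hw
          exact ⟨p, fun _ => hp⟩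
        · exact ⟨q, fun h => absurd h hw⟩
      choose P hP using hch
      have hBc : ∀ i, Tendsto (fun w => blockProj r i w) (𝓝[K] (G 0)) (𝓝 (c i • f i z₀)) := by
        intro i
        have := (LinearMap.toContinuousLinearMap (blockProj r i)).continuous.tendsto (G 0)
        simp only [LinearMap.coe_toContinuousLinearMap'] at this
        rw [hG0, blockProj_blockComb, ← hG0] at this
        exact this.mono_left nhdsWithin_le_nhds
      have hxc : ∀ i, Tendsto (fun w => x i (blockProj r i w)) (𝓝[K] (G 0)) (𝓝 (c i)) := by
        intro i
        have := ((x i).continuous.tendsto _).comp (hBc i)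
        simpa [(hL i).norm_eq z₀ hz, Function.comp_def] using this
      have hPt : Tendsto P (𝓝[K] (G 0)) (𝓝 q) := by
        refine tendsto_def.2 fun V hV => ?_
        have h1 := (hφ j).eventually_mem (w₀ := c j • f j z₀) (p := q) (by
          rw [(hL j).submodule_eq q hq]
          exact (Submodule.span_singleton_smul_eq (IsUnit.mk0 _ hj) _).symm) hV
        filter_upwards [hBc j h1, self_mem_nhdsWithin, (hxc j).eventually_ne hj]
          with w hw1 hwc hw3
        refine hw1 _ ?_
        have hm := hP w hwc j
        have h0 : blockProj r j w ≠ 0 := by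
          intro h0
          simp [h0] at hw3
        refine ((Submodule.eq_of_le_of_finrank_eq
          ((Submodule.span_singleton_le_iff_mem _ _).2 hm) ?_)).symm
        rw [finrank_span_singleton h0, Projectivization.finrank_submodule]
      have he : Tendsto (fun w => e (P w)) (𝓝[K] (G 0)) (𝓝 z₀) :=
        (e.continuousAt hq).tendsto.comp hPt
      have hat : Tendsto (fun w => x j (blockProj r j w) / c j) (𝓝[K] (G 0)) (𝓝 1) := by
        simpa [hj] using (hxc j).div_const (c j)
      -- Block j has coefficient c_j up to the cone scalar, which is thus x_j/c_j; dividing the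
      -- other x_i by that scalar recovers c_i + u_i.
      refine Filter.le_map_of_section (s := fun w => (x j (blockProj r j w) / c j,
        fun i => if i = j then e (P w) - z₀ else
          x i (blockProj r i w) / (x j (blockProj r j w) / c j) - c i)) ?_ ?_
      · refine Tendsto.prodMk_nhds hat (tendsto_pi_nhds.2 fun i => ?_)
        by_cases hi : i = j
        · simpa [hi] using he.sub_const z₀
        · have := ((hxc i).div hat one_ne_zero).sub_const (c i)
          simpa [hi] using this
      · filter_upwards [self_mem_nhdsWithin, hPt (e.open_source.mem_nhds hq),
          hat.eventually_ne one_ne_zero] with w hw1 hw2 hw3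
        refine blockProj_ext fun i => ?_
        have hmem := (hL i).eq_smul_of_mem hw2 (hP w hw1 i)
        rw [map_smul, hG, blockProj_blockComb, smul_smul]
        simp only [if_true, add_sub_cancel]
        rw [hmem]
        simp only [map_smul, (hL i).norm_eq _ (e.map_source hw2), smul_eq_mul, mul_one]
        congr 1
        by_cases hi : i = j
        · subst hi
          simp [hj]
        · simp only [if_neg hi, add_sub_cancel]
          generalize x j (blockProj r j w) / c j = a at hw3
          field_simp

theorem mem_dualAnnihilator_scroll_iff (hL : ∀ i, IsLift (φ i) e (f i) (x i) (y i))
    (hφ : ∀ i, IsProjEmbedding (φ i)) {q : C} (hq : q ∈ e.source) {c : Fin n → ℂ}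
    {X : ℙ ℂ (ScrollIdx r → ℂ)} (hX : X.submodule = ℂ ∙ blockComb c (fun i => f i (e q)))
    (ξ : (ScrollIdx r → ℂ) →L[ℂ] ℂ) :
    (∀ w ∈ osculatingSpace 2 n (decomposableScroll φ) X, ξ w = 0) ↔
      (∀ i, (fun z => ξ (blockIncl r i (f i z))) =O[𝓝 (e q)] fun z => (z - e q) ^ 2) ∧
        (fun z => ∑ i, c i * ξ (blockIncl r i (f i z))) =O[𝓝 (e q)] fun z => (z - e q) ^ 3 := by
  have hc : ∃ j, c j ≠ 0 := by
    by_contra! h0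
    have h1 : blockComb c (fun i => f i (e q)) = 0 := by
      ext a
      simp [blockComb, h0]
    have h2 := X.finrank_submodule
    rw [hX, h1, Submodule.span_zero_singleton, finrank_bot] at h2
    exact zero_ne_one h2
  obtain ⟨j, hj⟩ := hc
  rw [(isLocalParam_scroll hL hφ hq hj hX).mem_dualAnnihilator_iff, ← isBigO_scroll_iff hj]
  · refine iff_of_eq (congrArg (fun F => F =O[𝓝 0] _) ?_)
    ext u
    simp [blockComb_eq_sum]
  · intro i
    have h1 := (hL i).analyticAt (e q) (e.map_source hq)
    exact (ξ.comp (LinearMap.toContinuousLinearMap (blockIncl r i))).continuous.continuousAt.comp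
      h1.continuousAt

end Scroll

/-! ### Flexes -/

theorem AnalyticAt.isBigO_pow_succ_iff_iteratedDeriv {h : ℂ → ℂ} {z₀ : ℂ} (hh : AnalyticAt ℂ h z₀)
    (k : ℕ) :
    h =O[𝓝 z₀] (fun z => (z - z₀) ^ (k + 1)) ↔ ∀ j ≤ k, iteratedDeriv j h z₀ = 0 := by
  have ha : AnalyticAt ℂ (fun t => h (z₀ + t)) 0 :=
    AnalyticAt.fun_comp (by simpa using hh) (analyticAt_const.add analyticAt_id)
  have h1 := ha.isBigO_pow_succ_iff k
  have h2 : ∀ j, iteratedFDeriv ℂ j (fun t => h (z₀ + t)) 0 = 0 ↔ iteratedDeriv j h z₀ = 0 := by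
    intro j
    rw [← norm_eq_zero, norm_iteratedFDeriv_eq_norm_iteratedDeriv, norm_eq_zero,
      iteratedDeriv_comp_const_add]
    simp only [add_zero]
  simp only [h2] at h1
  rw [← h1]
  constructor
  · intro hO
    have ht : Tendsto (fun t => z₀ + t) (𝓝 0) (𝓝 z₀) :=
      Continuous.tendsto' (by fun_prop) _ _ (by simp)
    refine (hO.comp_tendsto ht).trans (IsBigO.of_bound 1 (Eventually.of_forall fun t => ?_))
    simp
  · intro hO
    have ht : Tendsto (fun z => z - z₀) (𝓝 z₀) (𝓝 0) :=
      Continuous.tendsto' (by fun_prop) _ _ (by simp)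
    refine ((hO.comp_tendsto ht).congr_left fun t => by simp).trans
      (IsBigO.of_bound 1 (Eventually.of_forall fun t => ?_))
    simp

/-- This converts comparisons of annihilators back into inclusions of osculating spaces. -/
theorem Submodule.le_of_forall_functional {V : Type*} [NormedAddCommGroup V] [NormedSpace ℂ V]
    [FiniteDimensional ℂ V] {A B : Submodule ℂ V}
    (h : ∀ ξ : V →L[ℂ] ℂ, (∀ w ∈ B, ξ w = 0) → ∀ w ∈ A, ξ w = 0) : A ≤ B := by
  intro w hw
  by_contra hwB
  obtain ⟨η, hη, hηB⟩ := Submodule.exists_le_ker_of_notMem hwB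
  exact hη (h (LinearMap.toContinuousLinearMap η) (fun w hw => hηB hw) w hw)

section Flex
variable {C : Type*} [TopologicalSpace C] {ι : Type*} [Fintype ι]

/-- The second osculating space to the curve at the given point is its tangent line. -/
def IsFlex (φ : C → ℙ ℂ (ι → ℂ)) (p : C) : Prop :=
  osculatingSpace 2 1 (Set.range φ) (φ p) = osculatingSpace 1 1 (Set.range φ) (φ p)

theorem osculatingSpace_mono {k l d : ℕ} (h : k ≤ l) (X : Set (ℙ ℂ (ι → ℂ)))
    (x : ℙ ℂ (ι → ℂ)) : osculatingSpace k d X x ≤ osculatingSpace l d X x := by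
  refine Submodule.span_mono ?_
  rintro w ⟨F, hF, j, hj, m, rfl⟩
  exact ⟨F, hF, j, hj.trans h, m, rfl⟩

variable {φ : C → ℙ ℂ (ι → ℂ)} {e : OpenPartialHomeomorph C ℂ} {f : ℂ → ι → ℂ}
  {x y : (ι → ℂ) →L[ℂ] ℂ}

theorem IsLift.isBigO_sq_iff (h : IsLift φ e f x y) {z : ℂ} (hz : z ∈ e.target)
    (η : (ι → ℂ) →L[ℂ] ℂ) :
    (fun z => η (f z)) =O[𝓝 z] (fun w => (w - z) ^ 2) ↔ η (f z) = 0 ∧ η (deriv f z) = 0 := by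
  rw [(h.analyticAt_apply hz η).isBigO_pow_succ_iff_iteratedDeriv 1]
  constructor
  · intro h1
    refine ⟨by simpa using h1 0 (by norm_num), ?_⟩
    simpa [(h.hasDerivAt hz η).deriv] using h1 1 le_rfl
  · rintro ⟨h0, h1⟩ j hj
    interval_cases j
    · simpa using h0
    · simpa [(h.hasDerivAt hz η).deriv] using h1

theorem IsLift.hasDerivAt_deriv (h : IsLift φ e f x y) {z : ℂ} (hz : z ∈ e.target)
    (η : (ι → ℂ) →L[ℂ] ℂ) :
    HasDerivAt (fun z => η (deriv f z)) (η (deriv (deriv f) z)) z :=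
  η.hasFDerivAt.comp_hasDerivAt z (h.analyticAt z hz).deriv.differentiableAt.hasDerivAt

theorem IsLift.norm_deriv_deriv (h : IsLift φ e f x y) {z : ℂ} (hz : z ∈ e.target) :
    x (deriv (deriv f) z) = 0 := by
  have h1 := h.hasDerivAt_deriv hz x
  have h2 : (fun z => x (deriv f z)) =ᶠ[𝓝 z] fun _ => 0 := by
    filter_upwards [e.open_target.mem_nhds hz] with w hw using h.norm_deriv hw
  exact h1.unique ((hasDerivAt_const z (0 : ℂ)).congr_of_eventuallyEq h2)

theorem IsLift.isBigO_cube_iff (h : IsLift φ e f x y) {z : ℂ} (hz : z ∈ e.target)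
    (η : (ι → ℂ) →L[ℂ] ℂ) :
    (fun z => η (f z)) =O[𝓝 z] (fun w => (w - z) ^ 3) ↔
      η (f z) = 0 ∧ η (deriv f z) = 0 ∧ η (deriv (deriv f) z) = 0 := by
  have h2 : deriv (deriv fun z => η (f z)) z = η (deriv (deriv f) z) := by
    have : deriv (fun z => η (f z)) =ᶠ[𝓝 z] fun z => η (deriv f z) := by
      filter_upwards [e.open_target.mem_nhds hz] with w hw using (h.hasDerivAt hw η).deriv
    rw [this.deriv_eq, (h.hasDerivAt_deriv hz η).deriv]
  rw [(h.analyticAt_apply hz η).isBigO_pow_succ_iff_iteratedDeriv 2]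
  constructor
  · intro h1
    refine ⟨by simpa using h1 0 (by norm_num), ?_, ?_⟩
    · simpa [(h.hasDerivAt hz η).deriv] using h1 1 (by norm_num)
    · simpa [iteratedDeriv_succ, h2] using h1 2 le_rfl
  · rintro ⟨h0, h1, h3⟩ j hj
    interval_cases j
    · simpa using h0
    · simpa [(h.hasDerivAt hz η).deriv] using h1
    · simpa [iteratedDeriv_succ, h2] using h3

variable [ChartedSpace ℂ C] [CompactSpace C]

theorem IsLift.isFlex_iff_isBigO (h : IsLift φ e f x y) (hφ : IsProjEmbedding φ) {q : C}
    (hq : q ∈ e.source) :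
    IsFlex φ q ↔ ∀ η : (ι → ℂ) →L[ℂ] ℂ,
      (fun z => η (f z)) =O[𝓝 (e q)] (fun z => (z - e q) ^ 2) →
      (fun z => η (f z)) =O[𝓝 (e q)] (fun z => (z - e q) ^ 3) := by
  constructor
  · intro hf η h2
    rw [← h.mem_dualAnnihilator_iff hφ hq 1 η, ← hf] at h2
    exact (h.mem_dualAnnihilator_iff hφ hq 2 η).1 h2
  · intro hO
    refine le_antisymm (Submodule.le_of_forall_functional fun η hη => ?_)
      (osculatingSpace_mono one_le_two _ _)
    exact (h.mem_dualAnnihilator_iff hφ hq 2 η).2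
      (hO η ((h.mem_dualAnnihilator_iff hφ hq 1 η).1 hη))

/-- At a flex, all the Wronskians of normalized coordinates vanish. -/
theorem IsLift.isFlex_iff (h : IsLift φ e f x y) (hφ : IsProjEmbedding φ) {q : C}
    (hq : q ∈ e.source) :
    IsFlex φ q ↔ ∀ η : (ι → ℂ) →L[ℂ] ℂ, y (deriv f (e q)) * η (deriv (deriv f) (e q)) -
      η (deriv f (e q)) * y (deriv (deriv f) (e q)) = 0 := by
  have hz := e.map_source hq
  rw [h.isFlex_iff_isBigO hφ hq]
  simp only [h.isBigO_sq_iff hz, h.isBigO_cube_iff hz]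
  constructor
  · intro H η
    set a := y (deriv f (e q))
    set b := η (deriv f (e q))
    -- The combination a η - b y kills f′; subtracting a multiple of x kills the value without
    -- changing derivatives, since x∘f is constant. Its value on f″ is the Wronskian.
    have := H (a • η - b • y - (a * η (f (e q)) - b * y (f (e q))) • x)
      ⟨by simp [h.norm_eq _ hz], by simp [h.norm_deriv hz, a, b, mul_comm]⟩
    simpa [h.norm_deriv_deriv hz] using this.2.2
  · rintro H η ⟨h0, h1⟩
    refine ⟨h0, h1, ?_⟩
    simpa [h1, h.deriv_ne _ hz] using H η

theorem IsLift.osculatingSpace_one (h : IsLift φ e f x y) (hφ : IsProjEmbedding φ) {q : C}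
    (hq : q ∈ e.source) : osculatingSpace 1 1 (Set.range φ) (φ q) =
      Submodule.span ℂ {f (e q), deriv f (e q)} := by
  have hz := e.map_source hq
  have key : ∀ η : (ι → ℂ) →L[ℂ] ℂ, (∀ w ∈ osculatingSpace 1 1 (Set.range φ) (φ q), η w = 0) ↔
      ∀ w ∈ Submodule.span ℂ {f (e q), deriv f (e q)}, η w = 0 := by
    intro η
    rw [h.mem_dualAnnihilator_iff hφ hq 1 η, h.isBigO_sq_iff hz]
    constructor
    · rintro ⟨h0, h1⟩ w hw
      obtain ⟨a, b, rfl⟩ := Submodule.mem_span_pair.1 hw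
      simp [h0, h1]
    · intro H
      exact ⟨H _ (Submodule.subset_span (by simp)), H _ (Submodule.subset_span (by simp))⟩
  exact le_antisymm (Submodule.le_of_forall_functional fun η => (key η).2)
    (Submodule.le_of_forall_functional fun η => (key η).1)

theorem IsLift.finrank_osculatingSpace_one (h : IsLift φ e f x y) (hφ : IsProjEmbedding φ) {q : C}
    (hq : q ∈ e.source) : Module.finrank ℂ (osculatingSpace 1 1 (Set.range φ) (φ q)) = 2 := by
  have hz := e.map_source hq
  rw [h.osculatingSpace_one hφ hq]
  have hli : LinearIndependent ℂ ![f (e q), deriv f (e q)] :=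
    LinearIndependent.pair_iff.2 fun a b hab => h.immersion hz hab
  have := finrank_span_eq_card hli
  rwa [Matrix.range_cons_cons_empty, Fintype.card_fin] at this

end Flex

/-! ### The inflectional locus -/

section Scroll
variable {n : ℕ} {r : Fin n → ℕ}

theorem finrank_iSup_map_blockIncl (T : ∀ i, Submodule ℂ (Fin (r i + 1) → ℂ)) :
    Module.finrank ℂ (⨆ i ∈ (Finset.univ : Finset (Fin n)), (T i).map (blockIncl r i) :
      Submodule ℂ (ScrollIdx r → ℂ)) = ∑ i, Module.finrank ℂ (T i) := by
  set Ψ : (∀ i, T i) →ₗ[ℂ] (ScrollIdx r → ℂ) :=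
    ∑ i, (blockIncl r i ∘ₗ (T i).subtype ∘ₗ LinearMap.proj i) with hΨ
  have hΨa : ∀ g, Ψ g = ∑ i, blockIncl r i (g i : Fin (r i + 1) → ℂ) := by
    intro g
    simp [hΨ]
  have hinj : Function.Injective Ψ := by
    intro g g' hg
    ext1 i
    apply Subtype.ext
    have := congrArg (blockProj r i) hg
    rwa [hΨa, hΨa, blockProj_sum_blockIncl (fun i => (g i : Fin (r i + 1) → ℂ)),
      blockProj_sum_blockIncl (fun i => (g' i : Fin (r i + 1) → ℂ))] at this
  have hrange : LinearMap.range Ψ = ⨆ i ∈ (Finset.univ : Finset (Fin n)),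
      (T i).map (blockIncl r i) := by
    ext w
    rw [mem_iSup_map_blockIncl]
    constructor
    · rintro ⟨g, rfl⟩ i
      rw [hΨa, blockProj_sum_blockIncl (fun i => (g i : Fin (r i + 1) → ℂ))]
      simp
    · intro hw
      refine ⟨fun i => ⟨blockProj r i w, (hw i).1⟩, ?_⟩
      rw [hΨa]
      exact sum_blockIncl_blockProj w
  rw [← hrange, LinearMap.finrank_range_of_inj hinj, Module.finrank_pi_fintype]

variable {C : Type*} {φ : ∀ i, C → ℙ ℂ (Fin (r i + 1) → ℂ)}

/-- The span of the tangent lines of the curves at corresponding points. -/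
def tangentSpan (φ : ∀ i, C → ℙ ℂ (Fin (r i + 1) → ℂ)) (p : C) : Submodule ℂ (ScrollIdx r → ℂ) :=
  ⨆ i ∈ (Finset.univ : Finset (Fin n)), curveOsc φ 1 i p

open Classical in
/-- The set of the indices of the curves with a flex at `p`. -/
def flexSet (φ : ∀ i, C → ℙ ℂ (Fin (r i + 1) → ℂ)) (p : C) : Finset (Fin n) :=
  {i | IsFlex (φ i) p}

theorem mem_flexSet {p : C} {i : Fin n} : i ∈ flexSet φ p ↔ IsFlex (φ i) p := by
  simp [flexSet]

/-- At a flex the second osculating space is the tangent line, so any flexed curve may carry the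
order 2 term. -/
theorem tangentSpan_eq_of_isFlex {p : C} {i : Fin n} (hi : IsFlex (φ i) p) :
    tangentSpan φ p = curveOsc φ 2 i p ⊔ ⨆ j ∈ Finset.univ.erase i, curveOsc φ 1 j p := by
  have h : curveOsc φ 2 i p = curveOsc φ 1 i p := by
    rw [curveOsc, curveOsc]
    exact congrArg _ hi
  rw [h, tangentSpan, ← Finset.insert_erase (Finset.mem_univ i), Finset.iSup_insert,
    Finset.erase_insert_eq_erase, Finset.erase_idem]

variable [TopologicalSpace C] [ChartedSpace ℂ C] [CompactSpace C] [IsManifold 𝓘(ℂ, ℂ) ω C]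

theorem finrank_tangentSpan (hφ : ∀ i, IsProjEmbedding (φ i)) (p : C) :
    Module.finrank ℂ (tangentSpan φ p) = 2 * n := by
  obtain ⟨e, f, x, y, hp, -, hL⟩ := exists_common_lift hφ p
  have h1 := finrank_iSup_map_blockIncl (r := r)
    (fun i => osculatingSpace 1 1 (Set.range (φ i)) (φ i p))
  refine h1.trans ?_
  rw [Finset.sum_congr rfl fun i _ => (hL i).finrank_osculatingSpace_one (hφ i) hp]
  simp [mul_comm]

/-- Functionals killing `Osc^2` satisfy the order 2 conditions defining the annihilator of
`tangentSpan`, plus one order 3 condition on Σ c_i ξ∘f_i. The latter is automatic exactly when order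
2 implies order 3 on each curve with c_i ≠ 0. -/
theorem tangentSpan_le_and_eq_iff (hφ : ∀ i, IsProjEmbedding (φ i)) {p : C}
    {X : ℙ ℂ (ScrollIdx r → ℂ)} (hX : X.submodule ≤ fibreSpan φ Finset.univ p) :
    tangentSpan φ p ≤ osculatingSpace 2 n (decomposableScroll φ) X ∧
      (osculatingSpace 2 n (decomposableScroll φ) X = tangentSpan φ p ↔
        X.submodule ≤ fibreSpan φ (flexSet φ p) p) := by
  obtain ⟨e, f, x, y, hp, -, hL⟩ := exists_common_lift hφ p
  have hz := e.map_source hp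
  have hw : X.submodule = ℂ ∙ X.rep := Projectivization.submodule_eq X
  set w := X.rep
  rw [hw, Submodule.span_singleton_le_iff_mem, mem_fibreSpan_iff] at hX
  set c : Fin n → ℂ := fun i => x i (blockProj r i w) with hc
  have hwc : ∀ i, blockProj r i w = c i • f i (e p) := fun i => (hL i).eq_smul_of_mem hp (hX i).1
  have hwc' : w = blockComb c (fun i => f i (e p)) := blockProj_ext fun i => by simp [hwc]
  have hXc : X.submodule = ℂ ∙ blockComb c (fun i => f i (e p)) := by rw [hw, hwc']
  have hosc := mem_dualAnnihilator_scroll_iff hL hφ hp hXc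
  have htan : ∀ ξ : (ScrollIdx r → ℂ) →L[ℂ] ℂ, (∀ w ∈ tangentSpan φ p, ξ w = 0) ↔
      ∀ i, (fun z => ξ (blockIncl r i (f i z))) =O[𝓝 (e p)] fun z => (z - e p) ^ 2 := by
    intro ξ
    have h1 : ∀ i, (∀ w ∈ curveOsc φ 1 i p, ξ w = 0) ↔
        (fun z => ξ (blockIncl r i (f i z))) =O[𝓝 (e p)] fun z => (z - e p) ^ 2 := by
      intro i
      have := (hL i).mem_dualAnnihilator_iff (hφ i) hp 1
        (ξ.comp (LinearMap.toContinuousLinearMap (blockIncl r i)))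
      rw [curveOsc]
      simpa using! this
    simp only [← h1]
    constructor
    · intro H i w hw
      exact H w (Submodule.mem_iSup_of_mem i (Submodule.mem_iSup_of_mem (Finset.mem_univ i) hw))
    · intro H
      have : tangentSpan φ p ≤ LinearMap.ker ξ.toLinearMap :=
        iSup₂_le fun i _ w hw => H i w hw
      exact fun w hw => this hw
  refine ⟨Submodule.le_of_forall_functional fun ξ hξ => (htan ξ).2 ((hosc ξ).1 hξ).1, ?_⟩
  have hmem : X.submodule ≤ fibreSpan φ (flexSet φ p) p ↔ ∀ i, c i ≠ 0 → IsFlex (φ i) p := by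
    rw [hw, Submodule.span_singleton_le_iff_mem, mem_fibreSpan_iff]
    refine forall_congr' fun i => ?_
    rw [mem_flexSet, hwc]
    simp only [smul_eq_zero, (hL i).ne_zero hz, or_false]
    rw [← hwc]
    have := (hX i).1
    tauto
  rw [hmem]
  constructor
  · intro heq i hci
    rw [(hL i).isFlex_iff_isBigO (hφ i) hp]
    intro η hη
    -- A functional supported on block i reduces the weighted sum to c_i η∘f_i.
    set ξ : (ScrollIdx r → ℂ) →L[ℂ] ℂ :=
      η.comp (LinearMap.toContinuousLinearMap (blockProj r i)) with hξ
    have h1 : ∀ k v, ξ (blockIncl r k v) = η (blockProj r i (blockIncl r k v)) := fun k v => rfl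
    have h2 : ∀ k, k ≠ i → ∀ v, ξ (blockIncl r k v) = 0 := by
      intro k hk v
      rw [h1, blockProj_blockIncl_of_ne hk.symm, map_zero]
    have h3 : ∀ v, ξ (blockIncl r i v) = η v := by
      intro v
      rw [h1, blockProj_blockIncl]
    have h4 : ∀ w ∈ tangentSpan φ p, ξ w = 0 := by
      rw [htan]
      intro k
      rcases eq_or_ne k i with rfl | hk
      · simpa [h3] using hη
      · simpa [h2 k hk] using isBigO_zero _ _
    rw [← heq, hosc] at h4
    refine (h4.2.const_mul_left (c i)⁻¹).congr_left fun z => ?_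
    rw [Finset.sum_eq_single i]
    · simp [h3, hci]
    · intro k _ hk
      simp [h2 k hk]
    · simp
  · intro hfl
    refine le_antisymm (Submodule.le_of_forall_functional fun ξ hξ => ?_)
      (Submodule.le_of_forall_functional fun ξ hξ => (htan ξ).2 ((hosc ξ).1 hξ).1)
    rw [htan] at hξ
    rw [hosc]
    refine ⟨hξ, IsBigO.fun_sum fun i _ => ?_⟩
    by_cases hci : c i = 0
    · simpa [hci] using isBigO_zero _ _
    · exact (((hL i).isFlex_iff_isBigO (hφ i) hp).1 (hfl i hci)
        (ξ.comp (LinearMap.toContinuousLinearMap (blockIncl r i))) (hξ i)).const_mul_left _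

/-- The tangent span has projective dimension 2n - 1 and lies in `Osc^2`, so dimension below 2n
leaves only equality. -/
theorem mem_inflectionalLocus_iff (hφ : ∀ i, IsProjEmbedding (φ i)) {p : C}
    {X : ℙ ℂ (ScrollIdx r → ℂ)} (hX : X.submodule ≤ fibreSpan φ Finset.univ p) :
    X ∈ inflectionalLocus 2 n (decomposableScroll φ) ↔
      osculatingSpace 2 n (decomposableScroll φ) X = tangentSpan φ p := by
  have hXm : X ∈ decomposableScroll φ := Set.mem_iUnion.2 ⟨p, hX⟩
  have hle := (tangentSpan_le_and_eq_iff hφ hX).1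
  have hdim := finrank_tangentSpan hφ p
  constructor
  · rintro ⟨-, h⟩
    refine (Submodule.eq_of_le_of_finrank_le hle ?_).symm
    rw [projDim] at h
    push_cast at h
    omega
  · intro h
    refine ⟨hXm, ?_⟩
    rw [h, projDim, hdim]
    push_cast
    omega

theorem inflectionalLocus_eq (hφ : ∀ i, IsProjEmbedding (φ i)) :
    inflectionalLocus 2 n (decomposableScroll φ) =
      ⋃ p, linearSubspace (fibreSpan φ (flexSet φ p) p) := by
  ext X
  rw [Set.mem_iUnion]
  constructor
  · intro h
    obtain ⟨p, hp⟩ := Set.mem_iUnion.1 h.1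
    exact ⟨p, (tangentSpan_le_and_eq_iff hφ hp).2.1 ((mem_inflectionalLocus_iff hφ hp).1 h)⟩
  · rintro ⟨p, hp⟩
    have hp' : X.submodule ≤ fibreSpan φ Finset.univ p :=
      le_trans hp (biSup_mono fun i _ => Finset.mem_univ i)
    exact (mem_inflectionalLocus_iff hφ hp').2 ((tangentSpan_le_and_eq_iff hφ hp').2.2 hp)

end Scroll

/-! ### Finiteness of the set of flexes -/

section Flex
variable {C : Type*} [TopologicalSpace C] {ι : Type*} [Fintype ι]

theorem OpenPartialHomeomorph.tendsto_punctured {D : Type*} [TopologicalSpace D]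
    (e : OpenPartialHomeomorph C D) {p : C} (hp : p ∈ e.source) :
    Tendsto e (𝓝[≠] p) (𝓝[≠] (e p)) := by
  refine tendsto_nhdsWithin_iff.2 ⟨(e.continuousAt hp).tendsto.mono_left nhdsWithin_le_nhds, ?_⟩
  filter_upwards [self_mem_nhdsWithin, nhdsWithin_le_nhds (e.open_source.mem_nhds hp)]
    with q hq hqs h
  exact hq (e.injOn hqs hp h)

variable [ChartedSpace ℂ C] [IsManifold 𝓘(ℂ, ℂ) ω C] {φ : C → ℙ ℂ (ι → ℂ)}

theorem IsProjEmbedding.exists_lift_chart (hφ : IsProjEmbedding φ) (p : C) :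
    ∃ (e : OpenPartialHomeomorph C ℂ) (f : ℂ → ι → ℂ) (x y : (ι → ℂ) →L[ℂ] ℂ),
      p ∈ e.source ∧ IsLift φ e f x y := by
  obtain ⟨e, f, x, y, hp, -, hL⟩ := exists_common_lift (κ := Unit) (φ := fun _ => φ)
    (fun _ => hφ) p
  exact ⟨e, f (), x (), y (), hp, hL ()⟩

variable [CompactSpace C]

/-- Identity theorem for the Wronskians. It is applied to the finitely many coordinate functionals,
so that one neighbourhood serves all; linearity in η gives the rest. -/
theorem IsProjEmbedding.eventually_isFlex_of_frequently (hφ : IsProjEmbedding φ) {p : C}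
    (h : ∃ᶠ q in 𝓝[≠] p, IsFlex φ q) : ∀ᶠ q in 𝓝 p, IsFlex φ q := by
  classical
  obtain ⟨e, f, x, y, hp, hL⟩ := hφ.exists_lift_chart p
  have hz := e.map_source hp
  set W : ((ι → ℂ) →L[ℂ] ℂ) → ℂ → ℂ := fun η z =>
    y (deriv f z) * η (deriv (deriv f) z) - η (deriv f z) * y (deriv (deriv f) z) with hW
  have hfa := hL.analyticAt _ hz
  have ha1 : ∀ η : (ι → ℂ) →L[ℂ] ℂ, AnalyticAt ℂ (fun z => η (deriv f z)) (e p) := fun η =>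
    (η.analyticAt _).comp hfa.deriv
  have ha2 : ∀ η : (ι → ℂ) →L[ℂ] ℂ, AnalyticAt ℂ (fun z => η (deriv (deriv f) z)) (e p) := fun η =>
    (η.analyticAt _).comp hfa.deriv.deriv
  have hWa : ∀ η, AnalyticAt ℂ (W η) (e p) := fun η =>
    ((ha1 y).mul (ha2 η)).sub ((ha1 η).mul (ha2 y))
  have hs : ∀ᶠ q in 𝓝 p, q ∈ e.source := e.open_source.mem_nhds hp
  have hW0 : ∀ η, ∀ᶠ z in 𝓝 (e p), W η z = 0 := by
    intro η
    rw [← (hWa η).frequently_zero_iff_eventually_zero]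
    refine (e.tendsto_punctured hp).frequently ?_
    refine (h.and_eventually (nhdsWithin_le_nhds hs)).mono ?_
    rintro q ⟨hq, hqs⟩
    exact (hL.isFlex_iff hφ hqs).1 hq η
  have hW1 : ∀ᶠ z in 𝓝 (e p), ∀ k : ι,
      W (ContinuousLinearMap.proj (R := ℂ) (φ := fun _ : ι => ℂ) k) z = 0 :=
    eventually_all.2 fun k => hW0 _
  filter_upwards [hs, (e.continuousAt hp).eventually hW1] with q hqs hq
  rw [hL.isFlex_iff hφ hqs]
  intro η
  have hη : ∀ v : ι → ℂ, η v = ∑ k, η (Pi.single k 1) * v k := by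
    intro v
    conv_lhs => rw [pi_eq_sum_univ' v]
    simp [map_sum, mul_comm]
  rw [hη (deriv f (e q)), hη (deriv (deriv f) (e q)), Finset.mul_sum, Finset.sum_mul,
    ← Finset.sum_sub_distrib]
  refine Finset.sum_eq_zero fun k _ => ?_
  have := hq k
  simp only [hW, ContinuousLinearMap.proj_apply] at this
  linear_combination η (Pi.single k 1) * this

/-- The interior of the set of flexes is closed, hence empty or everything. An infinite set of
flexes accumulates by compactness, which makes the interior nonempty. -/
theorem IsProjEmbedding.isFlex_or_finite [ConnectedSpace C] (hφ : IsProjEmbedding φ) :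
    (∀ p, IsFlex φ p) ∨ {p | IsFlex φ p}.Finite := by
  set A : Set C := {p | ∀ᶠ q in 𝓝 p, IsFlex φ q} with hA
  have hopen : IsOpen A := isOpen_iff_mem_nhds.2 fun p hp => by
    filter_upwards [eventually_eventually_nhds.2 hp] with q hq using hq
  have hclosed : IsClosed A := by
    refine isClosed_of_closure_subset fun p hp => ?_
    by_contra hpA
    refine hpA (hφ.eventually_isFlex_of_frequently ?_)
    rw [frequently_nhdsWithin_iff]
    refine (mem_closure_iff_frequently.1 hp).mono fun q hq => ⟨?_, ?_⟩
    · exact Eventually.self_of_nhds hq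
    · rintro rfl
      exact hpA hq
  rcases isClopen_iff.1 ⟨hclosed, hopen⟩ with h | h
  · right
    by_contra hinf
    obtain ⟨p, hp⟩ := Set.Infinite.exists_accPt_principal hinf
    rw [accPt_iff_frequently_nhdsNE] at hp
    have : p ∈ A := hφ.eventually_isFlex_of_frequently hp
    rw [h] at this
    exact this
  · left
    intro p
    have : p ∈ A := h ▸ Set.mem_univ p
    exact Eventually.self_of_nhds this

/-- Vanishing Wronskians make η(f′)/y(f′) locally constant, so a functional killing the tangent line
at p kills f nearby. The tangent line is thus locally constant, hence constant, and contains the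
curve; nondegeneracy makes it the whole space. -/
theorem IsProjEmbedding.card_eq_two_of_isFlex [ConnectedSpace C] (hφ : IsProjEmbedding φ)
    (hnd : IsNondegenerate φ) (hfl : ∀ p, IsFlex φ p) : Fintype.card ι = 2 := by
  set T : C → Submodule ℂ (ι → ℂ) := fun p => osculatingSpace 1 1 (Set.range φ) (φ p) with hT
  have hT2 : ∀ p, Module.finrank ℂ (T p) = 2 := by
    intro p
    obtain ⟨e, f, x, y, hp, hL⟩ := hφ.exists_lift_chart p
    exact hL.finrank_osculatingSpace_one hφ hp
  have hφT : ∀ p, (φ p).submodule ≤ T p := by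
    intro p
    obtain ⟨e, f, x, y, hp, hL⟩ := hφ.exists_lift_chart p
    rw [hL.submodule_eq p hp, Submodule.span_singleton_le_iff_mem]
    simp only [hT]
    rw [hL.osculatingSpace_one hφ hp]
    exact Submodule.subset_span (by simp)
  have hloc : ∀ p, ∀ᶠ q in 𝓝 p, T q = T p := by
    intro p
    obtain ⟨e, f, x, y, hp, hL⟩ := hφ.exists_lift_chart p
    have hz := e.map_source hp
    obtain ⟨ε, hε, hB⟩ := Metric.isOpen_iff.1 e.open_target _ hz
    have hpre : IsPreconnected (Metric.ball (e p) ε) := (convex_ball _ _).isPreconnected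
    have key : ∀ η : (ι → ℂ) →L[ℂ] ℂ, (∀ w ∈ T p, η w = 0) →
        ∀ z ∈ Metric.ball (e p) ε, η (f z) = 0 := by
      intro η hη z hzB
      have h0 := (hL.isBigO_sq_iff hz η).1 ((hL.mem_dualAnnihilator_iff hφ hp 1 η).1 hη)
      have hfl' : ∀ z ∈ e.target, y (deriv f z) * η (deriv (deriv f) z) -
          η (deriv f z) * y (deriv (deriv f) z) = 0 := by
        intro z hz
        have := (hL.isFlex_iff hφ (e.map_target hz)).1 (hfl _) η
        rwa [e.right_inv hz] at this
      have hd : ∀ z ∈ Metric.ball (e p) ε,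
          HasDerivAt (fun z => η (deriv f z) / y (deriv f z)) 0 z := by
        intro z hz
        have := (hL.hasDerivAt_deriv (hB hz) η).div (hL.hasDerivAt_deriv (hB hz) y)
          (hL.deriv_ne z (hB hz))
        rwa [div_eq_zero_iff.2 (Or.inl (by linear_combination hfl' z (hB hz)))] at this
      have hη1 : ∀ z ∈ Metric.ball (e p) ε, η (deriv f z) = 0 := by
        intro z hz
        have := Metric.isOpen_ball.is_const_of_deriv_eq_zero hpre
          (fun z hz => (hd z hz).differentiableAt.differentiableWithinAt)
          (fun z hz => (hd z hz).deriv) hz (Metric.mem_ball_self hε)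
        simp only [h0.2, zero_div, div_eq_zero_iff] at this
        exact this.resolve_right (hL.deriv_ne z (hB hz))
      have := Metric.isOpen_ball.is_const_of_deriv_eq_zero hpre
        (fun z hz => (hL.hasDerivAt (hB hz) η).differentiableAt.differentiableWithinAt)
        (fun z hz => (hL.hasDerivAt (hB hz) η).deriv.trans (hη1 z hz)) hzB (Metric.mem_ball_self hε)
      rw [this, h0.1]
    filter_upwards [e.open_source.mem_nhds hp,
      (e.continuousAt hp).eventually (Metric.ball_mem_nhds _ hε)] with q hqs hq
    refine Submodule.eq_of_le_of_finrank_eq ?_ ((hT2 q).trans (hT2 p).symm)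
    refine Submodule.le_of_forall_functional fun η hη => ?_
    refine (hL.mem_dualAnnihilator_iff hφ hqs 1 η).2 ?_
    refine IsBigO.of_bound 0 ?_
    filter_upwards [Metric.isOpen_ball.mem_nhds hq] with z hz
    simp [key η hη z hz]
  have hconst : IsLocallyConstant T := (IsLocallyConstant.iff_eventually_eq T).2 hloc
  obtain ⟨p₀⟩ := (inferInstance : Nonempty C)
  have htop : (⊤ : Submodule ℂ (ι → ℂ)) ≤ T p₀ := by
    rw [← hnd]
    refine iSup_le fun p => ?_
    rw [hconst.apply_eq_of_preconnectedSpace p₀ p]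
    exact hφT p
  have := hT2 p₀
  rw [top_le_iff.1 htop, finrank_top, Module.finrank_fintype_fun_eq_card] at this
  exact this

end Flex

/-! ### Points and functionals -/

section Points
variable {ι : Type*}

theorem rep_mem_submodule (x : ℙ ℂ (ι → ℂ)) : x.rep ∈ x.submodule := by
  rw [Projectivization.submodule_eq]
  exact Submodule.mem_span_singleton_self _

theorem submodule_eq_span_of_mem {x : ℙ ℂ (ι → ℂ)} {w : ι → ℂ} (h0 : w ≠ 0)
    (h : w ∈ x.submodule) : x.submodule = ℂ ∙ w := by
  rw [Projectivization.submodule_eq, Submodule.mem_span_singleton] at h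
  obtain ⟨a, rfl⟩ := h
  rw [Projectivization.submodule_eq]
  refine (Submodule.span_singleton_smul_eq (IsUnit.mk0 _ ?_) _).symm
  rintro rfl
  simp at h0

theorem eq_of_mem_submodule {x y : ℙ ℂ (ι → ℂ)} {w : ι → ℂ} (h0 : w ≠ 0)
    (hx : w ∈ x.submodule) (hy : w ∈ y.submodule) : x = y :=
  Projectivization.submodule_injective
    ((submodule_eq_span_of_mem h0 hx).trans (submodule_eq_span_of_mem h0 hy).symm)

/-- A point of the projective line is the zero locus of a linear functional. -/
theorem exists_functional_iff [Fintype ι] (hcard : Fintype.card ι = 2) (x : ℙ ℂ (ι → ℂ)) :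
    ∃ lam : (ι → ℂ) →L[ℂ] ℂ, ∀ w, lam w = 0 ↔ w ∈ x.submodule := by
  have hne : x.submodule ≠ ⊤ := by
    intro h
    have := x.finrank_submodule
    rw [h, finrank_top, Module.finrank_fintype_fun_eq_card, hcard] at this
    omega
  obtain ⟨v, -, hv⟩ := SetLike.exists_of_lt (lt_top_iff_ne_top.2 hne)
  obtain ⟨lam, hlam, hle⟩ := Submodule.exists_le_ker_of_notMem hv
  have hsurj : Function.Surjective lam := LinearMap.surjective (fun h => hlam (by simp [h]))
  have h1 := LinearMap.finrank_range_add_finrank_ker lam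
  rw [LinearMap.range_eq_top.2 hsurj, finrank_top, Module.finrank_self,
    Module.finrank_fintype_fun_eq_card, hcard] at h1
  have h2 : x.submodule = LinearMap.ker lam :=
    Submodule.eq_of_le_of_finrank_eq hle (by rw [x.finrank_submodule]; omega)
  refine ⟨LinearMap.toContinuousLinearMap lam, fun w => ?_⟩
  rw [h2]
  rfl

end Points

/-! ### Meromorphic functions without poles on compact Riemann surfaces -/

/-- A simple zero of t shared by s cancels; `dslope` is the quotient by z - z₀, extended by the
derivative. -/
theorem exists_analyticAt_div {s t : ℂ → ℂ} {z₀ : ℂ} (hs : AnalyticAt ℂ s z₀)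
    (ht : AnalyticAt ℂ t z₀) (h : t z₀ ≠ 0 ∨ s z₀ = 0 ∧ t z₀ = 0 ∧ deriv t z₀ ≠ 0) :
    ∃ u : ℂ → ℂ, AnalyticAt ℂ u z₀ ∧ ∀ᶠ z in 𝓝[≠] z₀, s z / t z = u z := by
  rcases h with h | ⟨hs0, ht0, ht1⟩
  · exact ⟨fun z => s z / t z, hs.div ht h, Eventually.of_forall fun z => rfl⟩
  · have hd : ∀ {g : ℂ → ℂ}, AnalyticAt ℂ g z₀ → AnalyticAt ℂ (dslope g z₀) z₀ := by
      rintro g ⟨p, hp⟩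
      exact ⟨_, HasFPowerSeriesAt.has_fpower_series_dslope_fslope ⟨_, hp.choose_spec⟩⟩
    refine ⟨fun z => dslope s z₀ z / dslope t z₀ z, (hd hs).div (hd ht) (by rwa [dslope_same]), ?_⟩
    filter_upwards [self_mem_nhdsWithin] with z hz
    rw [← sub_smul_dslope_of_zero hs0 z, ← sub_smul_dslope_of_zero ht0 z]
    exact mul_div_mul_left _ _ (sub_ne_zero.2 hz)

theorem OpenPartialHomeomorph.nhdsNE_neBot {C : Type*} [TopologicalSpace C] (e : OpenPartialHomeomorph C ℂ) {p : C}
    (hp : p ∈ e.source) : (𝓝[≠] p).NeBot := by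
  have := e.symm.tendsto_punctured (p := e p) (e.map_source hp)
  rw [e.left_inv hp] at this
  exact this.neBot

section LiftFunctionals
variable {C : Type*} [TopologicalSpace C]
variable {ι ι' : Type*} [Fintype ι] [Fintype ι'] {φ : C → ℙ ℂ (ι → ℂ)} {ψ : C → ℙ ℂ (ι' → ℂ)}

theorem IsLift.exists_rep_eq {e : OpenPartialHomeomorph C ℂ} {f : ℂ → ι → ℂ}
    {x y : (ι → ℂ) →L[ℂ] ℂ} (h : IsLift φ e f x y) {q : C} (hq : q ∈ e.source) :
    ∃ a : ℂ, a ≠ 0 ∧ (φ q).rep = a • f (e q) := by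
  have h1 := h.eq_smul_of_mem hq (rep_mem_submodule (φ q))
  refine ⟨_, fun h0 => ?_, h1⟩
  rw [h0, zero_smul] at h1
  exact (φ q).rep_nonzero h1

theorem IsLift.functional_eq_zero_iff {e : OpenPartialHomeomorph C ℂ} {f : ℂ → ι → ℂ}
    {x y : (ι → ℂ) →L[ℂ] ℂ} (h : IsLift φ e f x y) (hφ : Function.Injective φ) {q p : C}
    (hq : q ∈ e.source)
    {lam : (ι → ℂ) →L[ℂ] ℂ} (hlam : ∀ w, lam w = 0 ↔ w ∈ (φ p).submodule) :
    lam (f (e q)) = 0 ↔ q = p := by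
  have hm : f (e q) ∈ (φ q).submodule := by
    rw [h.submodule_eq q hq]
    exact Submodule.mem_span_singleton_self _
  rw [hlam]
  constructor
  · intro h1
    exact hφ (eq_of_mem_submodule (h.ne_zero (e.map_source hq)) hm h1)
  · rintro rfl
    exact hm

/-- The zero of λ∘f is simple: the kernel of λ is the line through f, and f′ is not on it. -/
theorem IsLift.functional_deriv_ne_zero {e : OpenPartialHomeomorph C ℂ} {f : ℂ → ι → ℂ}
    {x y : (ι → ℂ) →L[ℂ] ℂ} (h : IsLift φ e f x y) {p : C} (hp : p ∈ e.source)
    {lam : (ι → ℂ) →L[ℂ] ℂ} (hlam : ∀ w, lam w = 0 ↔ w ∈ (φ p).submodule) :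
    deriv (fun z => lam (f z)) (e p) ≠ 0 := by
  have hz := e.map_source hp
  rw [(h.hasDerivAt hz lam).deriv, Ne, hlam, h.submodule_eq p hp, Submodule.mem_span_singleton]
  rintro ⟨a, ha⟩
  have := (h.immersion hz (a := a) (b := -1) (by rw [ha]; simp)).2
  simp at this

theorem IsLift.exists_analyticAt_div {e : OpenPartialHomeomorph C ℂ} {f : ℂ → ι → ℂ}
    {x y : (ι → ℂ) →L[ℂ] ℂ} (h : IsLift φ e f x y) (hφ : Function.Injective φ)
    {g : ℂ → ι' → ℂ} {x' y' : (ι' → ℂ) →L[ℂ] ℂ} (h' : IsLift ψ e g x' y')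
    (hψ : Function.Injective ψ) {p p₁ : C}
    (hp : p ∈ e.source) {lam : (ι → ℂ) →L[ℂ] ℂ} (hlam : ∀ w, lam w = 0 ↔ w ∈ (φ p₁).submodule)
    {mu : (ι' → ℂ) →L[ℂ] ℂ} (hmu : ∀ w, mu w = 0 ↔ w ∈ (ψ p₁).submodule) :
    ∃ u : ℂ → ℂ, AnalyticAt ℂ u (e p) ∧ ∀ᶠ z in 𝓝[≠] (e p), lam (f z) / mu (g z) = u z := by
  have hz := e.map_source hp
  refine _root_.exists_analyticAt_div (h.analyticAt_apply hz lam) (h'.analyticAt_apply hz mu) ?_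
  rw [Ne, h'.functional_eq_zero_iff hψ hp hmu, h.functional_eq_zero_iff hφ hp hlam]
  rcases eq_or_ne p p₁ with rfl | hne
  · exact Or.inr ⟨rfl, rfl, h'.functional_deriv_ne_zero hp hmu⟩
  · exact Or.inl hne

end LiftFunctionals

section Rigidity
variable {C : Type*} [TopologicalSpace C] [ChartedSpace ℂ C]

theorem nhdsNE_neBot_of_chartedSpace (p : C) : (𝓝[≠] p).NeBot :=
  (chartAt ℂ p).nhdsNE_neBot (mem_chart_source ℂ p)

variable [CompactSpace C] [ConnectedSpace C] [IsManifold 𝓘(ℂ, ℂ) ω C]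

/-- A function with removable singularities only on a compact connected Riemann surface is
constant. -/
theorem exists_eventually_eq_const (g : C → ℂ)
    (h : ∀ p, ∃ (e : OpenPartialHomeomorph C ℂ) (u : ℂ → ℂ), p ∈ e.source ∧
      MDifferentiableAt 𝓘(ℂ, ℂ) 𝓘(ℂ, ℂ) e p ∧ AnalyticAt ℂ u (e p) ∧
      ∀ᶠ q in 𝓝[≠] p, g q = u (e q)) :
    ∃ κ : ℂ, ∀ p, ∀ᶠ q in 𝓝[≠] p, g q = κ := by
  choose e u hpe hed hu hgu using h
  have ht : ∀ p, Tendsto g (𝓝[≠] p) (𝓝 (u p (e p (p)))) := by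
    intro p
    have h1 : ContinuousAt (fun q => u p (e p q)) p :=
      ContinuousAt.comp (hu p).continuousAt ((e p).continuousAt (hpe p))
    exact (h1.tendsto.mono_left nhdsWithin_le_nhds).congr'
      ((hgu p).mono fun q hq => hq.symm)
  -- The extension takes at each point the limit of g there. Uniqueness of limits identifies it near
  -- p with u p ∘ e p, so it is holomorphic, hence constant.
  set g' : C → ℂ := fun p => u p (e p p) with hg'
  have hloc : ∀ p, ∀ᶠ q in 𝓝 p, g' q = u p (e p q) := by
    intro p
    have h1 : ∀ᶠ q in 𝓝[≠] p, ∀ᶠ q' in 𝓝[≠] p, g q' = u p (e p q') :=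
      Eventually.of_forall fun _ => hgu p
    have h2 := eventually_nhdsWithin_iff.1 (hgu p)
    have h3 := eventually_eventually_nhds.2 h2
    have h4 := (hu p).eventually_analyticAt
    have h5 := ((e p).continuousAt (hpe p)).eventually h4
    filter_upwards [h3, h5, (e p).open_source.mem_nhds (hpe p)] with q hq hqa hqs
    rcases eq_or_ne q p with rfl | hqp
    · rfl
    · have := nhdsNE_neBot_of_chartedSpace q
      refine tendsto_nhds_unique (ht q) ?_
      have h6 : ContinuousAt (fun q => u p (e p q)) q :=
        ContinuousAt.comp hqa.continuousAt ((e p).continuousAt hqs)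
      refine (h6.tendsto.mono_left nhdsWithin_le_nhds).congr' ?_
      have h7 : ∀ᶠ q' in 𝓝 q, q' ≠ p := by
        have : ∀ᶠ q' in 𝓝 q, q' ∈ (e p).source := (e p).open_source.mem_nhds hqs
        have h8 : e p q ≠ e p p := fun h => hqp ((e p).injOn hqs (hpe p) h)
        filter_upwards [((e p).continuousAt hqs).eventually_ne h8] with q' hq' h9
        exact hq' (by rw [h9])
      filter_upwards [nhdsWithin_le_nhds hq, nhdsWithin_le_nhds h7] with q' hq' hne
      exact (hq' hne).symm
  have hmd : MDifferentiable 𝓘(ℂ, ℂ) 𝓘(ℂ, ℂ) g' := by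
    intro p
    have h1 : MDifferentiableAt 𝓘(ℂ, ℂ) 𝓘(ℂ, ℂ) (u p) (e p p) :=
      (hu p).differentiableAt.mdifferentiableAt
    exact (h1.comp p (hed p)).congr_of_eventuallyEq (hloc p)
  have : IsManifold 𝓘(ℂ, ℂ) 1 C := IsManifold.of_le (n := ω) le_top
  obtain ⟨κ, hκ⟩ := hmd.exists_eq_const_of_compactSpace
  refine ⟨κ, fun p => ?_⟩
  filter_upwards [hgu p, nhdsWithin_le_nhds (hloc p)] with q h1 h2
  rw [h1, ← h2, hκ]
  rfl

variable {ι : Type*} [Fintype ι] {φ : C → ℙ ℂ (ι → ℂ)}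

/-- A nondegenerate embedding in the projective line is onto. -/
theorem IsProjEmbedding.range_eq_univ (hφ : IsProjEmbedding φ) (hnd : IsNondegenerate φ)
    (hcard : Fintype.card ι = 2) : Set.range φ = Set.univ := by
  refine Set.eq_univ_of_forall fun x => ?_
  by_contra hx
  obtain ⟨lam, hlam⟩ := exists_functional_iff hcard x
  have hne : ∀ q, ∀ w ∈ (φ q).submodule, w ≠ 0 → lam w ≠ 0 := by
    intro q w hw hw0 hl
    exact hx ⟨q, eq_of_mem_submodule hw0 hw ((hlam w).1 hl)⟩
  obtain ⟨mu₀, hmu₀, -⟩ := Submodule.exists_le_ker_of_notMem (K := ℂ) (p := ⊥) (v := x.rep)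
    (by simpa using x.rep_nonzero)
  set mu : (ι → ℂ) →L[ℂ] ℂ := LinearMap.toContinuousLinearMap mu₀
  have hmu : mu x.rep ≠ 0 := hmu₀
  -- If x were omitted, λ would have no zero on the curve, so μ/λ would be a constant κ. Then μ - κλ
  -- kills the whole curve but not x, against nondegeneracy.
  obtain ⟨κ, hκ⟩ := exists_eventually_eq_const (fun q => mu (φ q).rep / lam (φ q).rep) (by
    intro p
    obtain ⟨e, f, a, b, hp, hed, hL⟩ := exists_common_lift (κ := Unit) (φ := fun _ => φ)
      (fun _ => hφ) p
    replace hL := hL ()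
    have hz := e.map_source hp
    refine ⟨e, fun z => mu (f () z) / lam (f () z), hp, hed p hp,
      (hL.analyticAt_apply hz mu).div (hL.analyticAt_apply hz lam) ?_, ?_⟩
    · refine hne p _ ?_ (hL.ne_zero hz)
      rw [hL.submodule_eq p hp]
      exact Submodule.mem_span_singleton_self _
    · filter_upwards [nhdsWithin_le_nhds (e.open_source.mem_nhds hp)] with q hq
      obtain ⟨c, hc, h1⟩ := hL.exists_rep_eq hq
      rw [h1]
      simp only [map_smul, smul_eq_mul]
      exact mul_div_mul_left _ _ hc)
  have hval : ∀ p, ∀ w ∈ (φ p).submodule, (mu - κ • lam) w = 0 := by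
    intro p w hw
    obtain ⟨e, f, a, b, hp, hL⟩ := hφ.exists_lift_chart p
    have hz := e.map_source hp
    have h0 : (mu - κ • lam) (f (e p)) = 0 := by
      have := nhdsNE_neBot_of_chartedSpace p
      have hc : ContinuousAt (fun q => (mu - κ • lam) (f (e q))) p :=
        ContinuousAt.comp (g := fun z => (mu - κ • lam) (f z))
          (hL.analyticAt_apply hz _).continuousAt (e.continuousAt hp)
      refine tendsto_nhds_unique (l := 𝓝[≠] p) (hc.tendsto.mono_left nhdsWithin_le_nhds)
        (tendsto_const_nhds.congr' ?_)
      filter_upwards [hκ p, nhdsWithin_le_nhds (e.open_source.mem_nhds hp)] with q hq hqs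
      obtain ⟨c, hc, h1⟩ := hL.exists_rep_eq hqs
      rw [div_eq_iff (hne q _ (rep_mem_submodule _) (φ q).rep_nonzero), h1] at hq
      simp only [map_smul, smul_eq_mul] at hq
      have : c * (mu (f (e q)) - κ * lam (f (e q))) = 0 := by linear_combination hq
      exact ((mul_eq_zero.1 this).resolve_left hc).symm
    rw [hL.eq_smul_of_mem hp hw, map_smul, h0, smul_zero]
  have htop : (⊤ : Submodule ℂ (ι → ℂ)) ≤ LinearMap.ker (mu - κ • lam).toLinearMap := by
    rw [← hnd]
    exact iSup_le fun p w hw => hval p w hw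
  have h1 : (mu - κ • lam) x.rep = 0 := htop (Submodule.mem_top (x := x.rep))
  have h2 : lam x.rep = 0 := (hlam _).2 (rep_mem_submodule x)
  simp [h2, hmu] at h1

/-- Two embeddings of a compact Riemann surface in the projective line differ by a projectivity. -/
theorem exists_linearEquiv_of_card_eq_two [T2Space C] {κ : Type*} [Finite κ] {ι : κ → Type*}
    [∀ i, Fintype (ι i)] {φ : ∀ i, C → ℙ ℂ (ι i → ℂ)} (hΦ : ∀ i, IsProjEmbedding (φ i)) (i j : κ)
    (hcard : Fintype.card (ι i) = 2) (hcard' : Fintype.card (ι j) = 2) :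
    ∃ A : (ι i → ℂ) ≃ₗ[ℂ] (ι j → ℂ),
      ∀ q, (φ i q).submodule.map A.toLinearMap = (φ j q).submodule := by
  have hlift : ∀ p, ∃ (e : OpenPartialHomeomorph C ℂ) (f : ℂ → ι i → ℂ) (g : ℂ → ι j → ℂ)
      (x y : (ι i → ℂ) →L[ℂ] ℂ) (x' y' : (ι j → ℂ) →L[ℂ] ℂ), p ∈ e.source ∧
      MDifferentiableAt 𝓘(ℂ, ℂ) 𝓘(ℂ, ℂ) e p ∧ IsLift (φ i) e f x y ∧ IsLift (φ j) e g x' y' := by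
    intro p
    obtain ⟨e, f, x, y, hp, hed, hL⟩ := exists_common_lift hΦ p
    exact ⟨e, f i, f j, x i, y i, x j, y j, hp, hed p hp, hL i, hL j⟩
  have hφ := hΦ i
  have hψ := hΦ j
  generalize φ i = φ₁ at hφ hlift ⊢
  generalize φ j = ψ at hψ hlift ⊢
  obtain ⟨p₁⟩ := (inferInstance : Nonempty C)
  have hnb := nhdsNE_neBot_of_chartedSpace p₁
  obtain ⟨p₂, hp₂⟩ := (self_mem_nhdsWithin (a := p₁) (s := {p₁}ᶜ)) |> hnb.nonempty_of_mem
  have hp₂ : p₂ ≠ p₁ := hp₂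
  obtain ⟨lam₁, hlam₁⟩ := exists_functional_iff hcard (φ₁ p₁)
  obtain ⟨lam₂, hlam₂⟩ := exists_functional_iff hcard (φ₁ p₂)
  obtain ⟨mu₁, hmu₁⟩ := exists_functional_iff hcard' (ψ p₁)
  obtain ⟨mu₂, hmu₂⟩ := exists_functional_iff hcard' (ψ p₂)
  -- Numerators and denominators have matching simple zeros at p₁ and p₂. The function is
  -- independent of the representatives, and its values by division by zero at these points are
  -- ignored.
  obtain ⟨k, hk⟩ := exists_eventually_eq_const
    (fun q => lam₁ (φ₁ q).rep / mu₁ (ψ q).rep * (mu₂ (ψ q).rep / lam₂ (φ₁ q).rep)) (by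
    intro p
    obtain ⟨e, f, g, x, y, x', y', hp, hed, hL, hL'⟩ := hlift p
    obtain ⟨u₁, hu₁, hu₁'⟩ := hL.exists_analyticAt_div hφ.1 hL' hψ.1 hp hlam₁ hmu₁
    obtain ⟨u₂, hu₂, hu₂'⟩ := hL'.exists_analyticAt_div hψ.1 hL hφ.1 hp hmu₂ hlam₂
    refine ⟨e, fun z => u₁ z * u₂ z, hp, hed, hu₁.mul hu₂, ?_⟩
    filter_upwards [nhdsWithin_le_nhds (e.open_source.mem_nhds hp),
      (e.tendsto_punctured hp).eventually hu₁', (e.tendsto_punctured hp).eventually hu₂']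
      with q hq h1 h2
    obtain ⟨a, ha, hra⟩ := hL.exists_rep_eq hq
    obtain ⟨b, hb, hrb⟩ := hL'.exists_rep_eq hq
    rw [hra, hrb, ← h1, ← h2]
    simp only [map_smul, smul_eq_mul]
    rw [mul_div_mul_comm, mul_div_mul_comm]
    have : a / b * (b / a) = 1 := by field_simp
    linear_combination lam₁ (f (e q)) / mu₁ (g (e q)) * (mu₂ (g (e q)) / lam₂ (f (e q))) * this)
  have hne : ∀ {q}, q ≠ p₁ → q ≠ p₂ → lam₁ (φ₁ q).rep ≠ 0 ∧ lam₂ (φ₁ q).rep ≠ 0 ∧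
      mu₁ (ψ q).rep ≠ 0 ∧ mu₂ (ψ q).rep ≠ 0 := by
    intro q h1 h2
    refine ⟨fun h => h1 ?_, fun h => h2 ?_, fun h => h1 ?_, fun h => h2 ?_⟩
    · exact hφ.1 (eq_of_mem_submodule (φ₁ q).rep_nonzero (rep_mem_submodule _) ((hlam₁ _).1 h))
    · exact hφ.1 (eq_of_mem_submodule (φ₁ q).rep_nonzero (rep_mem_submodule _) ((hlam₂ _).1 h))
    · exact hψ.1 (eq_of_mem_submodule (ψ q).rep_nonzero (rep_mem_submodule _) ((hmu₁ _).1 h))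
    · exact hψ.1 (eq_of_mem_submodule (ψ q).rep_nonzero (rep_mem_submodule _) ((hmu₂ _).1 h))
  have hgen : ∀ p, ∀ᶠ q in 𝓝[≠] p, q ≠ p₁ ∧ q ≠ p₂ := by
    intro p
    have key : ∀ a : C, ∀ᶠ q in 𝓝[≠] p, q ≠ a := by
      intro a
      rcases eq_or_ne p a with rfl | h
      · exact self_mem_nhdsWithin
      · exact nhdsWithin_le_nhds (isOpen_ne.mem_nhds h)
    exact (key p₁).and (key p₂)
  have hk0 : k ≠ 0 := by
    obtain ⟨q, hq, h1, h2⟩ := ((hk p₁).and (hgen p₁)).exists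
    obtain ⟨n1, n2, n3, n4⟩ := hne h1 h2
    rw [← hq]
    exact mul_ne_zero (div_ne_zero n1 n3) (div_ne_zero n4 n2)
  have hrel : ∀ p, ∀ v ∈ (φ₁ p).submodule, ∀ w ∈ (ψ p).submodule,
      lam₁ v * mu₂ w = k * lam₂ v * mu₁ w := by
    intro p v hv w hw
    obtain ⟨e, f, g, x, y, x', y', hp, hed, hL, hL'⟩ := hlift p
    have hz := e.map_source hp
    have h0 : lam₁ (f (e p)) * mu₂ (g (e p)) - k * lam₂ (f (e p)) * mu₁ (g (e p)) = 0 := by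
      have := nhdsNE_neBot_of_chartedSpace p
      have ha : AnalyticAt ℂ (fun z => lam₁ (f z) * mu₂ (g z) - k * lam₂ (f z) * mu₁ (g z)) (e p) :=
        ((hL.analyticAt_apply hz _).mul (hL'.analyticAt_apply hz _)).sub
          ((analyticAt_const.mul (hL.analyticAt_apply hz _)).mul (hL'.analyticAt_apply hz _))
      have hc := ContinuousAt.comp ha.continuousAt (e.continuousAt hp)
      refine tendsto_nhds_unique (l := 𝓝[≠] p) (hc.tendsto.mono_left nhdsWithin_le_nhds)
        (tendsto_const_nhds.congr' ?_)
      filter_upwards [hk p, hgen p, nhdsWithin_le_nhds (e.open_source.mem_nhds hp)]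
        with q hq hq' hqs
      obtain ⟨n1, n2, n3, n4⟩ := hne hq'.1 hq'.2
      obtain ⟨a, ha, hra⟩ := hL.exists_rep_eq hqs
      obtain ⟨b, hb, hrb⟩ := hL'.exists_rep_eq hqs
      rw [div_mul_div_comm, div_eq_iff (mul_ne_zero n3 n2), hra, hrb] at hq
      simp only [map_smul, smul_eq_mul] at hq
      have : (a * b) * (lam₁ (f (e q)) * mu₂ (g (e q)) - k * lam₂ (f (e q)) * mu₁ (g (e q))) = 0 := by
        linear_combination hq
      exact ((mul_eq_zero.1 this).resolve_left (mul_ne_zero ha hb)).symm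
    rw [hL.eq_smul_of_mem hp hv, hL'.eq_smul_of_mem hp hw]
    simp only [map_smul, smul_eq_mul]
    linear_combination x v * x' w * h0
  -- The relation `hrel` says that (λ₁, kλ₂) on the first curve is proportional to (μ₁, μ₂) on the
  -- second. Both are coordinate systems, so matching them gives the projectivity.
  set L : (ι i → ℂ) →ₗ[ℂ] ℂ × ℂ := lam₁.toLinearMap.prod (k • lam₂.toLinearMap) with hLdef
  set M : (ι j → ℂ) →ₗ[ℂ] ℂ × ℂ := mu₁.toLinearMap.prod mu₂.toLinearMap with hMdef
  have hLinj : Function.Injective L := by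
    rw [← LinearMap.ker_eq_bot, LinearMap.ker_eq_bot']
    intro v hv
    by_contra hv0
    have h1 : lam₁ v = 0 := congrArg Prod.fst hv
    have h2 : k * lam₂ v = 0 := congrArg Prod.snd hv
    have h2 : lam₂ v = 0 := by simpa [hk0] using h2
    exact hp₂ (hφ.1 (eq_of_mem_submodule hv0 ((hlam₂ v).1 h2) ((hlam₁ v).1 h1)))
  have hMinj : Function.Injective M := by
    rw [← LinearMap.ker_eq_bot, LinearMap.ker_eq_bot']
    intro v hv
    by_contra hv0
    have h1 : mu₁ v = 0 := congrArg Prod.fst hv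
    have h2 : mu₂ v = 0 := congrArg Prod.snd hv
    exact hp₂ (hψ.1 (eq_of_mem_submodule hv0 ((hmu₂ v).1 h2) ((hmu₁ v).1 h1)))
  have hd : Module.finrank ℂ (ι i → ℂ) = Module.finrank ℂ (ℂ × ℂ) := by
    simp [hcard]
  have hd' : Module.finrank ℂ (ι j → ℂ) = Module.finrank ℂ (ℂ × ℂ) := by
    simp [hcard']
  set LE := LinearMap.linearEquivOfInjective L hLinj hd
  set ME := LinearMap.linearEquivOfInjective M hMinj hd'
  refine ⟨LE.trans ME.symm, fun q => ?_⟩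
  set v := (φ₁ q).rep
  set w := (ψ q).rep
  have hv0 : v ≠ 0 := (φ₁ q).rep_nonzero
  have hw0 : w ≠ 0 := (ψ q).rep_nonzero
  have hr := hrel q v (rep_mem_submodule _) w (rep_mem_submodule _)
  have hpar : ∃ t : ℂ, L v = t • M w := by
    have hM0 : M w ≠ 0 := fun h => hw0 (hMinj (by rw [h, map_zero]))
    by_cases h1 : mu₁ w = 0
    · have h2 : mu₂ w ≠ 0 := fun h2 => hM0 (Prod.ext h1 h2)
      refine ⟨k * lam₂ v / mu₂ w, Prod.ext ?_ ?_⟩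
      · have : lam₁ v = 0 := by
          have h3 : lam₁ v * mu₂ w = 0 := by rw [hr, h1, mul_zero]
          simpa [h2] using h3
        simp [hLdef, hMdef, this, h1]
      · simp [hLdef, hMdef, h2]
    · refine ⟨lam₁ v / mu₁ w, Prod.ext ?_ ?_⟩
      · simp [hLdef, hMdef, h1]
      · have : k * lam₂ v = lam₁ v / mu₁ w * mu₂ w := by
          field_simp
          linear_combination -hr
        exact this
  obtain ⟨t, ht⟩ := hpar
  have hA : (LE.trans ME.symm) v = t • w := by
    rw [LinearEquiv.trans_apply, LinearEquiv.symm_apply_eq, map_smul]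
    exact ht
  rw [Projectivization.submodule_eq, Projectivization.submodule_eq, Submodule.map_span,
    Set.image_singleton]
  change ℂ ∙ (LE.trans ME.symm) v = ℂ ∙ w
  rw [hA]
  refine Submodule.span_singleton_smul_eq (IsUnit.mk0 _ ?_) _
  rintro rfl
  rw [zero_smul] at hA
  exact hv0 ((LE.trans ME.symm).map_eq_zero_iff.1 hA)

end Rigidity

end

noncomputable section

/-! ### Zariski closed and irreducible subsets -/

section Zariski
variable {ι : Type*}

theorem eval_rep_ne_zero_iff {f : MvPolynomial ι ℂ} {d : ℕ} (hf : f.IsHomogeneous d)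
    {x : ℙ ℂ (ι → ℂ)} {w : ι → ℂ} (hw : x.submodule = ℂ ∙ w) :
    MvPolynomial.eval x.rep f ≠ 0 ↔ MvPolynomial.eval w f ≠ 0 := by
  have h := rep_mem_submodule x
  rw [hw, Submodule.mem_span_singleton] at h
  obtain ⟨a, ha⟩ := h
  have ha0 : a ≠ 0 := by
    rintro rfl
    exact x.rep_nonzero (by rw [← ha, zero_smul])
  have : MvPolynomial.eval x.rep f = a ^ d * MvPolynomial.eval w f := by
    rw [← ha]
    rw [MvPolynomial.eval_eq, MvPolynomial.eval_eq, Finset.mul_sum]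
    refine Finset.sum_congr rfl fun m hm => ?_
    have hd : ∑ i ∈ m.support, m i = d := by
      simpa [Finsupp.weight_apply, Finsupp.sum] using hf (MvPolynomial.mem_support_iff.1 hm)
    simp only [Pi.smul_apply, smul_eq_mul, mul_pow, Finset.prod_mul_distrib,
      Finset.prod_pow_eq_pow_sum, hd]
    ring
  rw [this, mul_ne_zero_iff]
  exact and_iff_right (pow_ne_zero _ ha0)

theorem isClosed_zeroLocus {f : MvPolynomial ι ℂ} {d : ℕ} (hf : f.IsHomogeneous d) :
    @IsClosed _ (zariskiTopology ι) {x | MvPolynomial.eval x.rep f = 0} := by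
  let _ := zariskiTopology ι
  rw [← isOpen_compl_iff]
  exact TopologicalSpace.isOpen_generateFrom_of_mem ⟨f, d, hf, rfl⟩

/-- Nonvanishing loci are stable under intersection by multiplying polynomials, so the generating
family is a basis. -/
theorem exists_basicOpen_subset {U : Set (ℙ ℂ (ι → ℂ))} (hU : @IsOpen _ (zariskiTopology ι) U)
    {x : ℙ ℂ (ι → ℂ)} (hx : x ∈ U) : ∃ (f : MvPolynomial ι ℂ) (d : ℕ), f.IsHomogeneous d ∧
      MvPolynomial.eval x.rep f ≠ 0 ∧ {y : ℙ ℂ (ι → ℂ) | MvPolynomial.eval y.rep f ≠ 0} ⊆ U := by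
  induction (hU : TopologicalSpace.GenerateOpen _ U) with
  | basic s hs =>
    obtain ⟨f, d, hf, rfl⟩ := hs
    exact ⟨f, d, hf, hx, subset_rfl⟩
  | univ => exact ⟨1, 0, MvPolynomial.isHomogeneous_one _ _, by simp, Set.subset_univ _⟩
  | inter s t hs ht ihs iht =>
    obtain ⟨f, d, hf, hfx, hfs⟩ := ihs hx.1
    obtain ⟨g, d', hg, hgx, hgt⟩ := iht hx.2
    refine ⟨f * g, d + d', hf.mul hg, by simp [hfx, hgx], fun y hy => ?_⟩
    have hy : MvPolynomial.eval y.rep (f * g) ≠ 0 := hy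
    rw [map_mul, mul_ne_zero_iff] at hy
    exact ⟨hfs hy.1, hgt hy.2⟩
  | sUnion S hS ih =>
    obtain ⟨s, hs, hxs⟩ := hx
    obtain ⟨f, d, hf, hfx, hfs⟩ := ih s hs hxs
    exact ⟨f, d, hf, hfx, hfs.trans (Set.subset_sUnion_of_mem hs)⟩

/-- A nonempty subset of projective space with a polynomial parametrization is irreducible. -/
theorem isIrreducible_of_parametrization {σ : Type*} {S : Set (ℙ ℂ (ι → ℂ))}
    (P : ι → MvPolynomial σ ℂ)
    (hS : ∀ x : ℙ ℂ (ι → ℂ),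
      x ∈ S ↔ ∃ v : σ → ℂ, x.submodule = ℂ ∙ (fun i => MvPolynomial.eval v (P i)))
    (hne : S.Nonempty) : @IsIrreducible _ (zariskiTopology ι) S := by
  let _ := zariskiTopology ι
  have hcomp : ∀ (f : MvPolynomial ι ℂ) (v : σ → ℂ), MvPolynomial.eval v (MvPolynomial.aeval P f) =
      MvPolynomial.eval (fun i => MvPolynomial.eval v (P i)) f := by
    intro f v
    have := MvPolynomial.comp_aeval_apply (R := ℂ) P (MvPolynomial.aeval v : MvPolynomial σ ℂ →ₐ[ℂ] ℂ) f
    simpa [MvPolynomial.coe_aeval_eq_eval] using this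
  have hnz : ∃ k, P k ≠ 0 := by
    obtain ⟨x, hx⟩ := hne
    obtain ⟨v, hv⟩ := (hS x).1 hx
    by_contra! h0
    have h1 := x.finrank_submodule
    have h2 : (fun i => MvPolynomial.eval v (P i)) = 0 := by
      ext i
      simp [h0]
    rw [hv, h2, Submodule.span_zero_singleton, finrank_bot] at h1
    exact zero_ne_one h1
  obtain ⟨k, hk⟩ := hnz
  refine ⟨hne, ?_⟩
  have key : ∀ U : Set (ℙ ℂ (ι → ℂ)), IsOpen U → (S ∩ U).Nonempty →
      ∃ (f : MvPolynomial ι ℂ) (d : ℕ), f.IsHomogeneous d ∧ MvPolynomial.aeval P f ≠ 0 ∧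
        {y : ℙ ℂ (ι → ℂ) | MvPolynomial.eval y.rep f ≠ 0} ⊆ U := by
    rintro U hU ⟨x, hxS, hxU⟩
    obtain ⟨f, d, hf, hfx, hfU⟩ := exists_basicOpen_subset hU hxU
    obtain ⟨v, hv⟩ := (hS x).1 hxS
    refine ⟨f, d, hf, fun h0 => ?_, hfU⟩
    rw [eval_rep_ne_zero_iff hf hv, ← hcomp, h0, map_zero] at hfx
    exact hfx rfl
  intro U V hU hV hSU hSV
  obtain ⟨f, d, hf, hf0, hfU⟩ := key U hU hSU
  obtain ⟨g, d', hg, hg0, hgV⟩ := key V hV hSV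
  -- The extra factor P k ensures that the chosen v maps to a nonzero vector, hence to a point.
  have hprod : MvPolynomial.aeval P f * MvPolynomial.aeval P g * P k ≠ 0 :=
    mul_ne_zero (mul_ne_zero hf0 hg0) hk
  have hv : ∃ v : σ → ℂ, MvPolynomial.eval v
      (MvPolynomial.aeval P f * MvPolynomial.aeval P g * P k) ≠ 0 := by
    by_contra! h
    exact hprod (MvPolynomial.funext fun v => by rw [h v, map_zero])
  obtain ⟨v, hv⟩ := hv
  rw [map_mul, map_mul, mul_ne_zero_iff, mul_ne_zero_iff, hcomp, hcomp] at hv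
  have hw : (fun i => MvPolynomial.eval v (P i)) ≠ 0 := fun h => hv.2 (congrFun h k)
  have hsub := Projectivization.submodule_mk (K := ℂ) _ hw
  refine ⟨Projectivization.mk ℂ _ hw, (hS _).2 ⟨v, hsub⟩, hfU ?_, hgV ?_⟩
  · exact (eval_rep_ne_zero_iff hf hsub).2 hv.1.1
  · exact (eval_rep_ne_zero_iff hg hsub).2 hv.1.2

/-- A linear form as a polynomial. -/
def linearForm {σ : Type*} [Fintype σ] (L : (σ → ℂ) →ₗ[ℂ] ℂ) : MvPolynomial σ ℂ := by
  classical exact ∑ s, MvPolynomial.C (L (Pi.single s 1)) * MvPolynomial.X s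

theorem eval_linearForm {σ : Type*} [Fintype σ] (L : (σ → ℂ) →ₗ[ℂ] ℂ) (v : σ → ℂ) :
    MvPolynomial.eval v (linearForm L) = L v := by
  classical
  conv_rhs => rw [pi_eq_sum_univ' v]
  simp only [linearForm, map_sum, map_mul, MvPolynomial.eval_C, MvPolynomial.eval_X, map_smul,
    smul_eq_mul]
  exact Finset.sum_congr rfl fun s _ => mul_comm _ _

theorem isHomogeneous_linearForm {σ : Type*} [Fintype σ] (L : (σ → ℂ) →ₗ[ℂ] ℂ) :
    (linearForm L).IsHomogeneous 1 := by
  classical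
  refine MvPolynomial.IsHomogeneous.sum _ _ _ fun s _ => ?_
  simpa using (MvPolynomial.isHomogeneous_C σ _).mul (MvPolynomial.isHomogeneous_X ℂ s)

theorem isClosed_linearSubspace [Fintype ι] (T : Submodule ℂ (ι → ℂ)) :
    @IsClosed _ (zariskiTopology ι) (linearSubspace T) := by
  let _ := zariskiTopology ι
  have : linearSubspace T = ⋂ L ∈ {L : (ι → ℂ) →ₗ[ℂ] ℂ | T ≤ LinearMap.ker L},
      {x | MvPolynomial.eval x.rep (linearForm L) = 0} := by
    ext x
    rw [linearSubspace, Set.mem_ofPred_eq, Projectivization.submodule_eq,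
      Submodule.span_singleton_le_iff_mem]
    simp only [Set.mem_iInter, Set.mem_ofPred_eq, eval_linearForm]
    constructor
    · intro hx L hL
      exact hL hx
    · intro h
      by_contra hx
      obtain ⟨L, hL, hLT⟩ := Submodule.exists_le_ker_of_notMem hx
      exact hL (h L hLT)
  rw [this]
  exact isClosed_biInter fun L _ => isClosed_zeroLocus (isHomogeneous_linearForm L)

theorem isIrreducible_linearSubspace [Fintype ι] {T : Submodule ℂ (ι → ℂ)} (hT : (linearSubspace T).Nonempty) :
    @IsIrreducible _ (zariskiTopology ι) (linearSubspace T) := by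
  obtain ⟨Q, hQ⟩ := LinearMap.exists_leftInverse_of_injective T.subtype (Submodule.ker_subtype T)
  have hQT : ∀ w ∈ T, (Q w : ι → ℂ) = w := fun w hw =>
    congrArg Subtype.val (LinearMap.congr_fun hQ ⟨w, hw⟩)
  -- A linear retraction Q onto T parametrizes the subspace by linear polynomials on the whole
  -- ambient space.
  refine isIrreducible_of_parametrization
    (fun i => linearForm (LinearMap.proj i ∘ₗ T.subtype ∘ₗ Q)) (fun x => ?_) hT
  simp only [eval_linearForm]
  constructor
  · intro hx
    refine ⟨x.rep, ?_⟩
    have h1 : (Q x.rep : ι → ℂ) = x.rep := hQT _ (hx (rep_mem_submodule x))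
    rw [Projectivization.submodule_eq]
    exact congrArg (fun w => ℂ ∙ w) h1.symm
  · rintro ⟨v, hv⟩
    rw [linearSubspace, Set.mem_ofPred_eq, hv, Submodule.span_singleton_le_iff_mem]
    exact (Q v).2

/-! ### The Segre variety -/

section Segre
variable {κ : Type*} {Λ : (Fin 2 × κ → ℂ) →ₗ[ℂ] (ι → ℂ)} (hΛ : Function.Injective Λ)

theorem mem_map_segreVariety {x : ℙ ℂ (ι → ℂ)} :
    x ∈ Projectivization.map Λ hΛ '' segreVariety κ ↔ ∃ a l, x.submodule = ℂ ∙ Λ (segre a l) := by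
  constructor
  · rintro ⟨y, ⟨a, l, -, -, hy⟩, rfl⟩
    refine ⟨a, l, ?_⟩
    induction y using Projectivization.ind with
    | h v hv =>
      rw [Projectivization.submodule_mk] at hy
      rw [Projectivization.map_mk, Projectivization.submodule_mk, ← Set.image_singleton,
        ← Set.image_singleton, ← Submodule.map_span, ← Submodule.map_span, hy]
  · rintro ⟨a, l, hx⟩
    have h0 : Λ (segre a l) ≠ 0 := by
      intro h0
      have h1 := x.finrank_submodule
      rw [hx, h0, Submodule.span_zero_singleton, finrank_bot] at h1
      exact zero_ne_one h1
    have hs : segre a l ≠ 0 := fun h => h0 (by rw [h, map_zero])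
    refine ⟨Projectivization.mk ℂ _ hs, ⟨a, l, ?_, ?_, Projectivization.submodule_mk _ _⟩, ?_⟩
    · rintro rfl
      exact hs (by ext; simp [segre])
    · rintro rfl
      exact hs (by ext; simp [segre])
    · apply Projectivization.submodule_injective
      rw [Projectivization.map_mk, Projectivization.submodule_mk, hx]

/-- A matrix with vanishing 2×2 minors has rank at most 1: take the row through a nonzero entry and
the column through it, normalized by that entry. -/
theorem eq_segre_of_minors {m : Fin 2 × κ → ℂ}
    (h : ∀ a b, m (0, a) * m (1, b) = m (0, b) * m (1, a)) : ∃ a l, m = segre a l := by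
  by_cases h0 : m = 0
  · exact ⟨0, 0, by ext; simp [h0, segre]⟩
  obtain ⟨⟨j₀, k₀⟩, hm⟩ := Function.ne_iff.1 h0
  have hm : m (j₀, k₀) ≠ 0 := hm
  refine ⟨fun j => m (j, k₀) / m (j₀, k₀), fun k => m (j₀, k), ?_⟩
  ext ⟨j, k⟩
  simp only [segre]
  rw [div_mul_eq_mul_div, eq_div_iff hm]
  fin_cases j <;> fin_cases j₀ <;> simp only [Fin.zero_eta, Fin.mk_one]
  · ring
  · exact h k k₀
  · linear_combination -h k k₀
  · ring

theorem isIrreducible_map_segreVariety [Finite κ]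
    (hne : (Projectivization.map Λ hΛ '' segreVariety κ).Nonempty) :
    @IsIrreducible _ (zariskiTopology ι) (Projectivization.map Λ hΛ '' segreVariety κ) := by
  classical
  have := Fintype.ofFinite κ
  refine isIrreducible_of_parametrization (σ := Fin 2 ⊕ κ)
    (fun i => ∑ jk : Fin 2 × κ, MvPolynomial.C (Λ (Pi.single jk 1) i) *
      (MvPolynomial.X (Sum.inl jk.1) * MvPolynomial.X (Sum.inr jk.2))) (fun x => ?_) hne
  have key : ∀ v : Fin 2 ⊕ κ → ℂ, (fun i => MvPolynomial.eval v
      (∑ jk : Fin 2 × κ, MvPolynomial.C (Λ (Pi.single jk 1) i) *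
        (MvPolynomial.X (Sum.inl jk.1) * MvPolynomial.X (Sum.inr jk.2)))) =
      Λ (segre (v ∘ Sum.inl) (v ∘ Sum.inr)) := by
    intro v
    conv_rhs => rw [pi_eq_sum_univ' (segre (v ∘ Sum.inl) (v ∘ Sum.inr))]
    ext i
    simp [segre, mul_comm]
  simp only [key]
  rw [mem_map_segreVariety]
  constructor
  · rintro ⟨a, l, h⟩
    exact ⟨Sum.elim a l, by simpa using h⟩
  · rintro ⟨v, h⟩
    exact ⟨_, _, h⟩

variable [Fintype ι]

theorem isClosed_map_segreVariety :
    @IsClosed _ (zariskiTopology ι) (Projectivization.map Λ hΛ '' segreVariety κ) := by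
  let _ := zariskiTopology ι
  obtain ⟨M, hM⟩ := LinearMap.exists_leftInverse_of_injective Λ (LinearMap.ker_eq_bot.2 hΛ)
  have hMΛ : ∀ m, M (Λ m) = m := LinearMap.congr_fun hM
  -- The 2×2 minors, pulled back by a left inverse of Λ, cut out the Segre variety inside the range
  -- of Λ.
  set F : κ → κ → MvPolynomial ι ℂ := fun a b =>
    linearForm (LinearMap.proj (0, a) ∘ₗ M) * linearForm (LinearMap.proj (1, b) ∘ₗ M) -
      linearForm (LinearMap.proj (0, b) ∘ₗ M) * linearForm (LinearMap.proj (1, a) ∘ₗ M) with hF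
  have hFh : ∀ a b, (F a b).IsHomogeneous 2 := fun a b =>
    ((isHomogeneous_linearForm _).mul (isHomogeneous_linearForm _)).sub
      ((isHomogeneous_linearForm _).mul (isHomogeneous_linearForm _))
  have : Projectivization.map Λ hΛ '' segreVariety κ = linearSubspace (LinearMap.range Λ) ∩
      ⋂ (a : κ) (b : κ), {x | MvPolynomial.eval x.rep (F a b) = 0} := by
    ext x
    rw [mem_map_segreVariety, Set.mem_inter_iff, linearSubspace, Set.mem_ofPred_eq]
    simp only [Set.mem_iInter, Set.mem_ofPred_eq, hF, map_sub, map_mul, eval_linearForm,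
      LinearMap.comp_apply, LinearMap.proj_apply, sub_eq_zero]
    constructor
    · rintro ⟨a, l, hx⟩
      refine ⟨by rw [hx, Submodule.span_singleton_le_iff_mem]; exact ⟨_, rfl⟩, fun b c => ?_⟩
      have hr := rep_mem_submodule x
      rw [hx, Submodule.mem_span_singleton] at hr
      obtain ⟨t, ht⟩ := hr
      rw [← ht, map_smul, hMΛ]
      simp only [segre, Pi.smul_apply, smul_eq_mul]
      ring
    · rintro ⟨hx, hmin⟩
      obtain ⟨m, hm⟩ := hx (rep_mem_submodule x)
      rw [← hm, hMΛ] at hmin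
      obtain ⟨a, l, rfl⟩ := eq_segre_of_minors hmin
      exact ⟨a, l, by rw [Projectivization.submodule_eq, hm]⟩
  rw [this]
  exact (isClosed_linearSubspace _).inter
    (isClosed_iInter fun a => isClosed_iInter fun b => isClosed_zeroLocus (hFh a b))

end Segre
end Zariski

/-! ### Scrolls generated by lines -/

section Lines
variable {C : Type*} {n : ℕ} {r : Fin n → ℕ} {S : Finset (Fin n)}

/-- The linear map which glues linear parametrizations of the lines `C_i`, `i ∈ S`, into a
parametrization of their span. -/
def segreGlue (B : ∀ i : S, (Fin 2 → ℂ) ≃ₗ[ℂ] (Fin (r i + 1) → ℂ)) :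
    (Fin 2 × S → ℂ) →ₗ[ℂ] (ScrollIdx r → ℂ) :=
  ∑ i : S, blockIncl r i ∘ₗ (B i).toLinearMap ∘ₗ LinearMap.funLeft ℂ ℂ (fun j => (j, i))

variable {B : ∀ i : S, (Fin 2 → ℂ) ≃ₗ[ℂ] (Fin (r i + 1) → ℂ)}

theorem segreGlue_apply (m : Fin 2 × S → ℂ) :
    segreGlue B m = ∑ i : S, blockIncl r i (B i fun j => m (j, i)) := by
  simp only [segreGlue, LinearMap.sum_apply, LinearMap.comp_apply]
  rfl

theorem blockProj_segreGlue (m : Fin 2 × S → ℂ) (i : S) :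
    blockProj r i (segreGlue B m) = B i fun j => m (j, i) := by
  rw [segreGlue_apply, map_sum, Finset.sum_eq_single i]
  · simp
  · intro k _ hk
    exact blockProj_blockIncl_of_ne (fun h => hk (Subtype.ext h.symm)) _
  · simp

theorem segreGlue_injective : Function.Injective (segreGlue B) := by
  intro m m' h
  ext ⟨j, i⟩
  have := congrArg (blockProj r i) h
  rw [blockProj_segreGlue, blockProj_segreGlue] at this
  exact congrFun ((B i).injective this) j

theorem segreGlue_segre (a : Fin 2 → ℂ) (l : S → ℂ) :
    segreGlue B (segre a l) = ∑ i : S, l i • blockIncl r i (B i a) := by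
  rw [segreGlue_apply]
  refine Finset.sum_congr rfl fun i _ => ?_
  rw [← map_smul, ← map_smul]
  congr 2
  ext j
  simp [segre, mul_comm]

variable {φ : ∀ i, C → ℙ ℂ (Fin (r i + 1) → ℂ)} {α : C → ℙ ℂ (Fin 2 → ℂ)}
  (hB : ∀ (i : S) (q : C), (α q).submodule.map (B i).toLinearMap = (φ i q).submodule)

include hB

theorem map_submodule_eq_span (i : S) (q : C) :
    (φ i q).submodule = ℂ ∙ B i (α q).rep := by
  rw [← hB i q, Projectivization.submodule_eq, Submodule.map_span, Set.image_singleton]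
  rfl

theorem mem_fibreSpan_iff_segre {q : C} {w : ScrollIdx r → ℂ} :
    w ∈ fibreSpan φ S q ↔ ∃ l : S → ℂ, w = segreGlue B (segre (α q).rep l) := by
  constructor
  · intro hw
    rw [mem_fibreSpan_iff] at hw
    have h1 : ∀ i : S, ∃ l : ℂ, l • B i (α q).rep = blockProj r i w := by
      intro i
      have := (hw i).1
      rwa [map_submodule_eq_span hB i q, Submodule.mem_span_singleton] at this
    choose l hl using h1
    refine ⟨l, ?_⟩
    rw [segreGlue_segre]
    conv_lhs => rw [← sum_blockIncl_blockProj w]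
    rw [← Finset.sum_subset (Finset.subset_univ S), ← Finset.sum_coe_sort S]
    · refine Finset.sum_congr rfl fun i _ => ?_
      rw [← hl i, map_smul]
    · intro i _ hi
      rw [(hw i).2 hi, map_zero]
  · rintro ⟨l, rfl⟩
    rw [segreGlue_segre]
    refine Submodule.sum_mem _ fun i _ => Submodule.smul_mem _ _ ?_
    refine Submodule.mem_iSup_of_mem (i : Fin n) (Submodule.mem_iSup_of_mem i.2
      (Submodule.mem_map_of_mem ?_))
    rw [map_submodule_eq_span hB i q]
    exact Submodule.mem_span_singleton_self _

/-- Each fibre is the Segre slice at `α q`, and surjectivity of α reaches every slice. -/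
theorem subScroll_eq_map_segre (hα : Function.Surjective α) :
    subScroll φ S =
      Projectivization.map (segreGlue B) segreGlue_injective '' segreVariety S := by
  ext x
  rw [mem_map_segreVariety, subScroll, Set.mem_iUnion]
  constructor
  · rintro ⟨q, hq⟩
    obtain ⟨l, hl⟩ := (mem_fibreSpan_iff_segre hB).1 (hq (rep_mem_submodule x))
    exact ⟨_, l, by rw [← hl, Projectivization.submodule_eq]⟩
  · rintro ⟨a, l, hx⟩
    have ha : a ≠ 0 := by
      rintro rfl
      have h1 := x.finrank_submodule
      have h2 : segre (0 : Fin 2 → ℂ) l = 0 := by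
        ext
        simp [segre]
      rw [hx, h2, map_zero, Submodule.span_zero_singleton, finrank_bot] at h1
      exact zero_ne_one h1
    obtain ⟨q, hq⟩ := hα (Projectivization.mk ℂ a ha)
    have hm : a ∈ (α q).submodule := by
      rw [hq, Projectivization.submodule_mk]
      exact Submodule.mem_span_singleton_self _
    rw [Projectivization.submodule_eq, Submodule.mem_span_singleton] at hm
    obtain ⟨t, ht⟩ := hm
    refine ⟨q, ?_⟩
    rw [linearSubspace, Set.mem_ofPred_eq, hx, Submodule.span_singleton_le_iff_mem,
      mem_fibreSpan_iff_segre hB]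
    refine ⟨t • l, ?_⟩
    congr 1
    ext ⟨j, k⟩
    rw [← ht]
    simp [segre]
    ring

theorem range_segreGlue (hα : Function.Surjective α) :
    LinearMap.range (segreGlue B) = ⨆ p, fibreSpan φ S p := by
  apply le_antisymm
  · rintro _ ⟨m, rfl⟩
    rw [segreGlue_apply]
    refine Submodule.sum_mem _ fun i _ => ?_
    by_cases h0 : (fun j => m (j, i)) = 0
    · rw [h0, map_zero, map_zero]
      exact zero_mem _
    · obtain ⟨q, hq⟩ := hα (Projectivization.mk ℂ _ h0)
      refine Submodule.mem_iSup_of_mem q (Submodule.mem_iSup_of_mem (i : Fin n)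
        (Submodule.mem_iSup_of_mem i.2 (Submodule.mem_map_of_mem ?_)))
      rw [← hB i q, hq, Projectivization.submodule_mk]
      exact Submodule.mem_map_of_mem (Submodule.mem_span_singleton_self _)
  · refine iSup_le fun q w hw => ?_
    obtain ⟨l, rfl⟩ := (mem_fibreSpan_iff_segre hB).1 hw
    exact ⟨_, rfl⟩

theorem isSegreScroll_subScroll (hα : Function.Surjective α) :
    IsSegreScroll φ S α (subScroll φ S) := by
  classical
  refine ⟨segreGlue B, segreGlue_injective, range_segreGlue hB hα, subScroll_eq_map_segre hB hα, ?_⟩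
  intro p i
  rw [map_submodule_eq_span hB i p, Submodule.map_span, Set.image_singleton]
  congr 2
  rw [segreGlue_segre, Finset.sum_eq_single i]
  · simp
  · intro k _ hk
    simp [hk]
  · simp

end Lines

/-- The dimension is a variable m so that m = 1 can be substituted in the types. -/
theorem exists_line_chart {C : Type*} [TopologicalSpace C] [ChartedSpace ℂ C] {m : ℕ} (hm : m = 1)
    {φ : C → ℙ ℂ (Fin (m + 1) → ℂ)} (hφ : IsProjEmbedding φ) (hs : Function.Surjective φ) :
    ∃ (α : C → ℙ ℂ (Fin 2 → ℂ)) (E : (Fin 2 → ℂ) ≃ₗ[ℂ] (Fin (m + 1) → ℂ)), IsProjEmbedding α ∧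
      Function.Surjective α ∧ ∀ q, (α q).submodule.map E.toLinearMap = (φ q).submodule := by
  subst hm
  exact ⟨φ, LinearEquiv.refl ℂ _, hφ, hs, fun q => Submodule.map_id _⟩

/-! ### Fibre spans and curves consisting of flexes -/

section FibreSpan
variable {C : Type*} {n : ℕ} {r : Fin n → ℕ} {φ : ∀ i, C → ℙ ℂ (Fin (r i + 1) → ℂ)}

theorem linearSubspace_bot {ι : Type*} : linearSubspace (⊥ : Submodule ℂ (ι → ℂ)) = ∅ := by
  ext x
  rw [linearSubspace, Set.mem_ofPred_eq, le_bot_iff]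
  refine iff_of_false (fun h => ?_) (Set.notMem_empty x)
  have h1 := x.finrank_submodule
  rw [h, finrank_bot] at h1
  exact zero_ne_one h1

theorem fibreSpan_empty (p : C) :
    fibreSpan φ ∅ p = ⊥ := by
  simp [fibreSpan]

theorem fibreSpan_mono {S T : Finset (Fin n)} (h : S ⊆ T) (p : C) :
    fibreSpan φ S p ≤ fibreSpan φ T p :=
  biSup_mono fun _ hi => h hi

theorem linearSubspace_mono {ι : Type*} {T T' : Submodule ℂ (ι → ℂ)} (h : T ≤ T') :
    linearSubspace T ⊆ linearSubspace T' := by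
  intro x hx
  rw [linearSubspace, Set.mem_ofPred_eq] at hx ⊢
  exact hx.trans h

open Classical in
/-- The set of the indices of the curves all of whose points are flexes. -/
def lineSet (φ : ∀ i, C → ℙ ℂ (Fin (r i + 1) → ℂ)) : Finset (Fin n) :=
  {i | ∀ p, IsFlex (φ i) p}

theorem mem_lineSet {i : Fin n} : i ∈ lineSet φ ↔ ∀ p, IsFlex (φ i) p := by
  simp [lineSet]

end FibreSpan

/-! ### Irreducible components of the inflectional locus -/

section Main
variable {C : Type*} [TopologicalSpace C] [CompactSpace C]
  [ConnectedSpace C] [ChartedSpace ℂ C] [IsManifold 𝓘(ℂ, ℂ) ω C]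
  {n : ℕ} {r : Fin n → ℕ} {φ : ∀ i, C → ℙ ℂ (Fin (r i + 1) → ℂ)}

theorem range_eq_univ_of_mem_lineSet (hφ : ∀ i, IsProjEmbedding (φ i))
    (hnd : ∀ i, IsNondegenerate (φ i)) {i : Fin n} (hi : i ∈ lineSet φ) :
    r i = 1 ∧ Set.range (φ i) = Set.univ := by
  have h := (hφ i).card_eq_two_of_isFlex (hnd i) (mem_lineSet.1 hi)
  refine ⟨by simpa using h, (hφ i).range_eq_univ (hnd i) h⟩

/-- An exceptional p is a flex of some curve outside `lineSet`, and each such curve has finitely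
many flexes. -/
theorem finite_flexSet_ne_lineSet (hφ : ∀ i, IsProjEmbedding (φ i)) :
    {p | flexSet φ p ≠ lineSet φ}.Finite := by
  have h : {p | flexSet φ p ≠ lineSet φ} ⊆ ⋃ i ∈ {i : Fin n | i ∉ lineSet φ}, {p | IsFlex (φ i) p} := by
    intro p hp
    by_contra hcon
    refine hp (Finset.ext fun i => ?_)
    rw [mem_flexSet]
    refine ⟨fun hi => ?_, fun hi => mem_lineSet.1 hi p⟩
    by_contra hiL
    exact hcon (Set.mem_biUnion (show i ∈ {i : Fin n | i ∉ lineSet φ} from hiL) hi)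
  refine Set.Finite.subset (Set.Finite.biUnion (Set.toFinite _) fun i hi => ?_) h
  exact ((hφ i).isFlex_or_finite).resolve_left fun h => hi (mem_lineSet.2 h)

variable [T2Space C]

/-- One line identifies C with ℙ¹; the others are compared with it by projectivities. -/
theorem exists_projective_line_chart (hφ : ∀ i, IsProjEmbedding (φ i))
    (hnd : ∀ i, IsNondegenerate (φ i)) (hne : (lineSet φ).Nonempty) :
    ∃ (α : C → ℙ ℂ (Fin 2 → ℂ)) (B : ∀ i : lineSet φ, (Fin 2 → ℂ) ≃ₗ[ℂ] (Fin (r i + 1) → ℂ)),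
      IsProjEmbedding α ∧ Function.Surjective α ∧
      ∀ (i : lineSet φ) (q : C), (α q).submodule.map (B i).toLinearMap = (φ i q).submodule := by
  obtain ⟨i₀, hi₀⟩ := hne
  have h₀ := range_eq_univ_of_mem_lineSet hφ hnd hi₀
  obtain ⟨α, E, hα, hαs, hE⟩ := exists_line_chart h₀.1 (hφ i₀) (Set.range_eq_univ.1 h₀.2)
  have h : ∀ i : lineSet φ, ∃ A : (Fin (r i₀ + 1) → ℂ) ≃ₗ[ℂ] (Fin (r i + 1) → ℂ),
      ∀ q, (φ i₀ q).submodule.map A.toLinearMap = (φ i q).submodule := fun i =>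
    exists_linearEquiv_of_card_eq_two hφ i₀ i (by simp [h₀.1])
      (by simp [(range_eq_univ_of_mem_lineSet hφ hnd i.2).1])
  choose A hA using h
  refine ⟨α, fun i => E.trans (A i), hα, hαs, fun i q => ?_⟩
  rw [← hA i q, ← hE q, ← Submodule.map_comp]
  rfl

theorem isClosed_subScroll_lineSet (hφ : ∀ i, IsProjEmbedding (φ i))
    (hnd : ∀ i, IsNondegenerate (φ i)) (hne : (lineSet φ).Nonempty) :
    @IsClosed _ (zariskiTopology _) (subScroll φ (lineSet φ)) := by
  obtain ⟨α, B, -, hαs, hB⟩ := exists_projective_line_chart hφ hnd hne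
  rw [subScroll_eq_map_segre hB hαs]
  exact isClosed_map_segreVariety _

theorem isIrreducible_subScroll_lineSet (hφ : ∀ i, IsProjEmbedding (φ i))
    (hnd : ∀ i, IsNondegenerate (φ i)) (hne : (subScroll φ (lineSet φ)).Nonempty)
    (hne' : (lineSet φ).Nonempty) :
    @IsIrreducible _ (zariskiTopology _) (subScroll φ (lineSet φ)) := by
  obtain ⟨α, B, -, hαs, hB⟩ := exists_projective_line_chart hφ hnd hne'
  rw [subScroll_eq_map_segre hB hαs] at hne ⊢
  exact isIrreducible_map_segreVariety _ hne

/-- The irreducible components of the inflectional locus are among the fibres over the finitely many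
points with additional flexes and the scroll generated by the lines. -/
theorem component_inflectionalLocus (hφ : ∀ i, IsProjEmbedding (φ i))
    (hnd : ∀ i, IsNondegenerate (φ i)) {G : Set (ℙ ℂ (ScrollIdx r → ℂ))}
    (hG : IsIrredComponentOf G (inflectionalLocus 2 n (decomposableScroll φ))) :
    (∃ p, G = linearSubspace (fibreSpan φ (flexSet φ p) p)) ∨
      (lineSet φ).Nonempty ∧ G = subScroll φ (lineSet φ) := by
  classical
  let _ := zariskiTopology (ScrollIdx r)
  obtain ⟨⟨hGsub, hGirr⟩, hmax⟩ := hG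
  rw [inflectionalLocus_eq hφ] at hGsub hmax
  have hfin := finite_flexSet_ne_lineSet hφ
  have hle : ∀ {p}, lineSet φ ⊆ flexSet φ p := fun hi =>
    mem_flexSet.2 (mem_lineSet.1 hi _)
  -- A finite closed cover of the locus: irreducibility puts G inside one member, and maximality
  -- gives equality because that member is irreducible and contained in the locus.
  set t : Finset (Set (ℙ ℂ (ScrollIdx r → ℂ))) := insert (subScroll φ (lineSet φ))
    (hfin.toFinset.image fun p => linearSubspace (fibreSpan φ (flexSet φ p) p)) with ht
  have hclosedL : IsClosed (subScroll φ (lineSet φ)) := by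
    rcases (lineSet φ).eq_empty_or_nonempty with h | h
    · have : subScroll φ (lineSet φ) = ∅ := by
        simp [subScroll, h, fibreSpan_empty, linearSubspace_bot]
      rw [this]
      exact isClosed_empty
    · exact isClosed_subScroll_lineSet hφ hnd h
  obtain ⟨Z, hZ, hGZ⟩ := isIrreducible_iff_sUnion_isClosed.1 hGirr t (by
    intro Z hZ
    rw [ht, Finset.mem_insert, Finset.mem_image] at hZ
    rcases hZ with rfl | ⟨p, -, rfl⟩
    · exact hclosedL
    · exact isClosed_linearSubspace _) (by
    intro x hx
    obtain ⟨p, hp⟩ := Set.mem_iUnion.1 (hGsub hx)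
    by_cases hpL : flexSet φ p = lineSet φ
    · refine ⟨subScroll φ (lineSet φ), by simp [ht], Set.mem_iUnion.2 ⟨p, ?_⟩⟩
      rwa [hpL] at hp
    · refine ⟨_, ?_, hp⟩
      rw [ht, Finset.mem_coe, Finset.mem_insert, Finset.mem_image]
      exact Or.inr ⟨p, by simpa using hpL, rfl⟩)
  obtain ⟨x, hx⟩ := hGirr.1
  rw [ht, Finset.mem_insert, Finset.mem_image] at hZ
  rcases hZ with rfl | ⟨p, -, rfl⟩
  · right
    have hne : (lineSet φ).Nonempty := by
      by_contra h
      obtain ⟨p, hp⟩ := Set.mem_iUnion.1 (hGZ hx)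
      rw [Finset.not_nonempty_iff_eq_empty.1 h, fibreSpan_empty, linearSubspace_bot] at hp
      exact hp
    refine ⟨hne, hGZ.antisymm (hmax ⟨?_, ?_⟩ hGZ)⟩
    · exact Set.iUnion_mono fun p => linearSubspace_mono (fibreSpan_mono hle p)
    · exact isIrreducible_subScroll_lineSet hφ hnd ⟨x, hGZ hx⟩ hne
  · left
    refine ⟨p, hGZ.antisymm (hmax ⟨?_, ?_⟩ hGZ)⟩
    · exact Set.subset_iUnion (fun p => linearSubspace (fibreSpan φ (flexSet φ p) p)) p
    · exact isIrreducible_linearSubspace ⟨x, hGZ hx⟩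

end Main

end

theorem proposition4p2 {C : Type*} [TopologicalSpace C] [T2Space C] [CompactSpace C]
    [ConnectedSpace C] [ChartedSpace ℂ C] [IsManifold 𝓘(ℂ, ℂ) ω C]
    (n : ℕ) (hn : 1 ≤ n) (r : Fin n → ℕ) (φ : ∀ i, C → ℙ ℂ (Fin (r i + 1) → ℂ))
    (hφ : ∀ i, IsProjEmbedding (φ i)) (hnd : ∀ i, IsNondegenerate (φ i))
    (hX : inflectionalLocus 2 n (decomposableScroll φ) ≠ decomposableScroll φ)
    (G : Set (ℙ ℂ (ScrollIdx r → ℂ)))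
    (hG : IsIrredComponentOf G (inflectionalLocus 2 n (decomposableScroll φ))) :
    (∃ S : Finset (Fin n), S.Nonempty ∧
      ((∃ p : C, G = linearSubspace (fibreSpan φ S p) ∧
          ∀ x ∈ G, ∀ i ∈ S, osculatingSpace 2 n (decomposableScroll φ) x =
            curveOsc φ 2 i p ⊔ ⨆ j ∈ Finset.univ.erase i, curveOsc φ 1 j p) ∨
        ((∃ α : C → ℙ ℂ (Fin 2 → ℂ),
            IsProjEmbedding α ∧ Function.Surjective α ∧ IsSegreScroll φ S α G) ∧
          (∀ i ∈ S, ∃ ℓ : Submodule ℂ (Fin (r i + 1) → ℂ),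
            projDim ℓ = 1 ∧ Set.range (φ i) = linearSubspace ℓ) ∧
          G = subScroll φ S ∧
          ∀ p : C, ∀ x ∈ G ∩ linearSubspace (fibreSpan φ Finset.univ p), ∀ i ∈ S,
            osculatingSpace 2 n (decomposableScroll φ) x =
              curveOsc φ 2 i p ⊔ ⨆ j ∈ Finset.univ.erase i, curveOsc φ 1 j p))) ∧
    ∀ x ∈ G, projDim (osculatingSpace 2 n (decomposableScroll φ) x) = 2 * (n : ℤ) - 1 := by
  have hosc : ∀ p, ∀ x ∈ inflectionalLocus 2 n (decomposableScroll φ),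
      x ∈ linearSubspace (fibreSpan φ Finset.univ p) →
      osculatingSpace 2 n (decomposableScroll φ) x = tangentSpan φ p := fun p x hx hxp =>
    (mem_inflectionalLocus_iff hφ hxp).1 hx
  have hGsub := hG.prop.1
  have hGne : G.Nonempty := hG.prop.2.1
  refine ⟨?_, fun x hx => ?_⟩
  -- The set S is `flexSet φ p` for a linear fibre and `lineSet φ` for the Segre scroll; in both,
  -- every index of S is a flex at the relevant p.
  · rcases component_inflectionalLocus hφ hnd hG with ⟨p, hGp⟩ | ⟨hne, hGL⟩
    · refine ⟨flexSet φ p, ?_, Or.inl ⟨p, hGp, fun x hx i hi => ?_⟩⟩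
      · by_contra h
        rw [Finset.not_nonempty_iff_eq_empty.1 h, fibreSpan_empty, linearSubspace_bot] at hGp
        exact hGne.ne_empty hGp
      · rw [hosc p x (hGsub hx), tangentSpan_eq_of_isFlex (mem_flexSet.1 hi)]
        rw [hGp] at hx
        exact linearSubspace_mono (fibreSpan_mono (Finset.subset_univ _) p) hx
    · obtain ⟨α, B, hα, hαs, hB⟩ := exists_projective_line_chart hφ hnd hne
      refine ⟨lineSet φ, hne, Or.inr ⟨⟨α, hα, hαs, ?_⟩, fun i hi => ⟨⊤, ?_, ?_⟩, hGL, ?_⟩⟩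
      · rw [hGL]
        exact isSegreScroll_subScroll hB hαs
      · have := (range_eq_univ_of_mem_lineSet hφ hnd hi).1
        rw [projDim, finrank_top, Module.finrank_fintype_fun_eq_card, Fintype.card_fin, this]
        norm_num
      · rw [(range_eq_univ_of_mem_lineSet hφ hnd hi).2, linearSubspace]
        simp
      · rintro p x ⟨hx, hxp⟩ i hi
        rw [hosc p x (hGsub hx) hxp, tangentSpan_eq_of_isFlex (mem_lineSet.1 hi p)]
  · obtain ⟨p, hp⟩ := Set.mem_iUnion.1 (hGsub hx).1
    rw [hosc p x (hGsub hx) hp, projDim, finrank_tangentSpan hφ]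
    push_cast
    ring
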